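/- **Notation.** For $v\in\mathbb R_+^d=[0,\infty)^d$ let $v^{(1)}\ge\dots\ge v^{(d)}$ be its ordered coordinates. Put $\mathbb{CA}_d^{(i)}=\{v\in\mathbb R_+^d: v^{(i+1)}=0\}$ for $0\le i\le d-1$ and $\mathbb E_d^{(i)}=\mathbb R_+^d\setminus\mathbb{CA}_d^{(i-1)}=\{v: v^{(i)}>0\}$ for $1\le i\le d$. Distances are taken in the sup-norm, and topological boundaries $\partial$ are taken in $\mathbb R_+^d$. $\mathbb M(\mathbb E_d^{(i)})$ is the class of Borel measures on $\mathbb E_d^{(i)}$ that are finite on Borel sets bounded away from $\mathbb{CA}_d^{(i-1)}$ (i.e. at positive distance from it); $\nu_t\to\nu$ in $\mathbb M(\mathbb E_d^{(i)})$ means $\int f\,d\nu_t\to\int f\,d\nu$ for all bounded continuous real $f$ with support bounded away from $\mathbb{CA}_d^{(i-1)}$. A random vector $V\in\mathbb R_+^d$ is in $\mathcal{MRV}(\alpha,b,\mu,\mathbb E_d^{(i)})$ if $\alpha\ge0$, $b\in\mathcal{RV}_{1/\alpha}$ (rapidly varying if $\alpha=0$), $0\ne\mu\in\mathbb M(\mathbb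 E_d^{(i)})$ and $t\,\mathbf P(V/b(t)\in\cdot)\to\mu$ in $\mathbb M(\mathbb E_d^{(i)})$ as $t\to\infty$; $V\in\mathcal{MRV}(\alpha,\mu,\mathbb E_d^{(i)})$ means that this holds for some $b$. For a matrix $A\in\mathbb R_+^{q\times d}$ let $A^{-1}(C)=\{z\in\mathbb R_+^d: Az\in C\}$ and $$\tau_{q,d}^{(k,i)}(A)=\sup_{z\in\mathbb E_d^{(i)}}\frac{(Az)^{(k)}}{z^{(i)}}\in[0,\infty].$$ For a random matrix $A$ let $\Omega_i^{(k)}$ be the event that $i=\max\{j\in\{1,\dots,d\}:\tau_{q,d}^{(k,j)}(A)<\infty\}$, and $\mathbf E_i^{(k)}[X]=\mathbf E[X\mathbf 1_{\Omega_i^{(k)}}]$. **Theorem.** Let $Z\in\mathbb R_+^d$ be a random vector such that for all $i=1,\dots,d$, $Z\in\mathcal{MRV}(\alpha_i,b_i,\mu_i,\mathbb E_d^{(i)})$ with the canonical scaling function $b_i(t)=\inf\{x:\mathbf P(Z^{(i)}\le x)\ge 1-1/t\}$, and $b_i(t)/b_{i+1}(t)\to\infty$ as $t\to\infty$ for $i=1,\dots,d-1$.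 Let $A\in\mathbb R_+^{q\times d}$ be a random matrix, independent of $Z$, with almost surely no zero row, and let $k\in\{1,\dots,q\}$. Suppose that for every $i=1,\dots,d$: (i) $\mathbf E_i^{(k)}\big[\tau_{q,d}^{(k,i)}(A)^{\alpha_i+\delta}\big]<\infty$ for some $\delta=\delta(i,k)>0$; (ii) for every $S\subseteq\{1,\dots,d\}$ with $|S|=i$, $\mu_i(\{v\in\mathbb R_+^d: v_j>0\iff j\in S\})>0$. Then the following hold. (a) Let $C\subset\mathbb E_q^{(k)}$ be a Borel set bounded away from $\mathbb{CA}_q^{(k-1)}$ with $\mathbf E_i^{(k)}[\mu_i(\partial A^{-1}(C))]=0$ (that is, $\mu_i(\partial A_\omega^{-1}(C))=0$ for almost every $\omega\in\Omega_i^{(k)}$) for all $i=1,\dots,d$. Then $\mathbf E_i^{(k)}[\mu_i(A^{-1}(C))]<\infty$ for all $i$, and $$\mathbf P(AZ\in tC)=\sum_{i=1}^d\mathbf P(Z^{(i)}>t)\Big[\mathbf E_i^{(k)}[\mu_i(A^{-1}(C))]+o(1)\Big],\qquad t\to\infty,$$ where the $i$-th summand on the right-hand side is $\mathbf P(\{AZ\in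 tC\}\cap\Omega_i^{(k)})$. (b) The index $i_k^*=\min\{i\in\{1,\dots,d\}:\mathbf P(\Omega_i^{(k)})>0\}$ exists. For every $C$ as in (a), $$\frac{\mathbf P(AZ\in tC)}{\mathbf P(Z^{(i_k^*)}>t)}\to\mathbf E_{i_k^*}^{(k)}\big[\mu_{i_k^*}(A^{-1}(C))\big]=:\overline\mu_k(C),\qquad t\to\infty.$$ Moreover $\overline\mu_k(\cdot)=\mathbf E_{i_k^*}^{(k)}[\mu_{i_k^*}(A^{-1}(\cdot))]$ is a measure in $\mathbb M(\mathbb E_q^{(k)})$, $\mathbf P(t^{-1}AZ\in\cdot)/\mathbf P(Z^{(i_k^*)}>t)\to\overline\mu_k$ in $\mathbb M(\mathbb E_q^{(k)})$, and $AZ\in\mathcal{MRV}(\alpha_{i_k^*},\overline\mu_k,\mathbb E_q^{(k)})$. -/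

import Mathlib

open MeasureTheory ProbabilityTheory Filter Topology
open scoped NNReal ENNReal Matrix Pointwise BoundedContinuousFunction

/-!
Vectors of `ℝ_+^d` are functions `Fin d → ℝ≥0`; their distance in Mathlib is the sup-norm distance.
All indices (`i`, `k`) are natural numbers counted from `1`.
-/

namespace Breiman

noncomputable section

/-- The Borel (entrywise product) σ-algebra on matrices. -/
instance instMeasurableSpaceMatrix {q d : ℕ} : MeasurableSpace (Matrix (Fin q) (Fin d) ℝ≥0) :=
  inferInstanceAs (MeasurableSpace (Fin q → Fin d → ℝ≥0))

/-- The `i`-th largest coordinate `v^{(i)}` of `v`, `1 ≤ i ≤ d`: the largest level that is reached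
by at least `i` coordinates. -/
def ordStat {d : ℕ} (v : Fin d → ℝ≥0) (i : ℕ) : ℝ≥0 :=
  sSup {r : ℝ≥0 | i ≤ (Finset.univ.filter fun j => r ≤ v j).card}

/-- `ordStat v i` is the entry with rank `i` when the coordinates are sorted decreasingly, that is,
the entry number `d - i` (from `0`) of the increasingly sorted tuple. -/
theorem ordStat_eq_sort {d : ℕ} (v : Fin d → ℝ≥0) (i : ℕ) (hi : 1 ≤ i) (hid : i ≤ d) :
    ordStat v i = v (Tuple.sort v ⟨d - i, by omega⟩) := by
  have hm : Monotone (v ∘ Tuple.sort v) := Tuple.monotone_sort v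
  have hc : ∀ r : ℝ≥0, (Finset.univ.filter fun j => r ≤ v j).card =
      (Finset.univ.filter fun j => r ≤ v (Tuple.sort v j)).card := by
    intro r
    symm
    refine Finset.card_bij (fun j _ => Tuple.sort v j) ?_ ?_ ?_
    · intro a ha
      simpa using ha
    · intro a _ b _ h
      exact (Tuple.sort v).injective h
    · intro b hb
      exact ⟨(Tuple.sort v).symm b, by simpa using hb, by simp⟩
  refine IsGreatest.csSup_eq ⟨?_, ?_⟩
  · rw [Set.mem_ofPred_eq, hc]
    have h1 : (Finset.Ici (⟨d - i, by omega⟩ : Fin d)).card = i := by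
      rw [Fin.card_Ici]
      simp
      omega
    calc i = (Finset.Ici (⟨d - i, by omega⟩ : Fin d)).card := h1.symm
      _ ≤ _ := Finset.card_le_card (by
        intro j hj
        rw [Finset.mem_Ici] at hj
        simpa using hm hj)
  · intro r hr
    rw [Set.mem_ofPred_eq, hc] at hr
    by_contra hlt
    rw [not_le] at hlt
    have h1 : (Finset.Ioi (⟨d - i, by omega⟩ : Fin d)).card = i - 1 := by
      rw [Fin.card_Ioi]
      simp
      omega
    have h2 : (Finset.univ.filter fun j => r ≤ v (Tuple.sort v j)).card ≤
        (Finset.Ioi (⟨d - i, by omega⟩ : Fin d)).card := Finset.card_le_card (by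
      intro j hj
      rw [Finset.mem_filter] at hj
      rw [Finset.mem_Ioi]
      by_contra hle
      exact absurd (lt_of_lt_of_le hlt (hj.2.trans (hm (not_lt.1 hle)))) (lt_irrefl _))
    omega

/-- `CA_d^{(i)} = {v : v^{(i+1)} = 0}`, `0 ≤ i ≤ d - 1`. -/
def CA (d i : ℕ) : Set (Fin d → ℝ≥0) := {v | ordStat v (i + 1) = 0}

/-- `E_d^{(i)} = ℝ_+^d ∖ CA_d^{(i-1)} = {v : v^{(i)} > 0}`, `1 ≤ i ≤ d`. -/
def E (d i : ℕ) : Set (Fin d → ℝ≥0) := {v | 0 < ordStat v i}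

/-- The coordinate face of vectors whose positive coordinates are exactly those in `S`. For `S`
running over the `i`-element sets these are the faces whose union is `CA_d^{(i)} ∖ CA_d^{(i-1)}`. -/
def face {d : ℕ} (S : Finset (Fin d)) : Set (Fin d → ℝ≥0) := {v | ∀ j, 0 < v j ↔ j ∈ S}

/-- `Λ` has positive distance from `C₀`. -/
def BoundedAway {d : ℕ} (C₀ Λ : Set (Fin d → ℝ≥0)) : Prop :=
  ∃ ε : ℝ, 0 < ε ∧ ∀ x ∈ Λ, ∀ y ∈ C₀, ε ≤ dist x y

/-- The class `M(ℝ_+^d ∖ C₀)`: Borel measures on `ℝ_+^d ∖ C₀` (encoded as measures on `ℝ_+^d` that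
give no mass to `C₀`) that are finite on Borel sets bounded away from `C₀`. -/
def InM {d : ℕ} (C₀ : Set (Fin d → ℝ≥0)) (μ : Measure (Fin d → ℝ≥0)) : Prop :=
  μ C₀ = 0 ∧ ∀ B, MeasurableSet B → BoundedAway C₀ B → μ B < ∞

/-- `ν_t → μ` in `M(ℝ_+^d ∖ C₀)` as `t → ∞`. The test functions vanish in a neighbourhood of `C₀`,
so only the restriction of `ν_t` to the complement of `C₀` matters; a bounded continuous function
on `ℝ_+^d ∖ C₀` with support bounded away from `C₀` extends by zero to one on `ℝ_+^d`. -/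
def MTendsto {d : ℕ} (C₀ : Set (Fin d → ℝ≥0)) (ν : ℝ≥0 → Measure (Fin d → ℝ≥0))
    (μ : Measure (Fin d → ℝ≥0)) : Prop :=
  InM C₀ μ ∧ ∀ f : (Fin d → ℝ≥0) →ᵇ ℝ, BoundedAway C₀ (Function.support f) →
    Tendsto (fun t => ∫ x, f x ∂(ν t)) atTop (𝓝 (∫ x, f x ∂μ))

/-- `x^{1/α}` for `x > 0` and `α ≥ 0`, where `x^{1/0} = x^∞` is `0`, `1`, `∞` for `x < 1`, `x = 1`,
`x > 1`. -/
def rpowInv (x : ℝ≥0) (α : ℝ) : ℝ≥0∞ :=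
  if α = 0 then (if x < 1 then 0 else if x = 1 then 1 else ∞) else ((x ^ (1 / α) : ℝ≥0) : ℝ≥0∞)

/-- `b ∈ RV_{1/α}`: regular variation at infinity with index `1/α` (rapid variation if `α = 0`). -/
def RVInv (α : ℝ) (b : ℝ≥0 → ℝ≥0) : Prop :=
  Measurable b ∧ (∀ᶠ t in atTop, 0 < b t) ∧
    ∀ x : ℝ≥0, 0 < x →
      Tendsto (fun t => ((b (t * x) / b t : ℝ≥0) : ℝ≥0∞)) atTop (𝓝 (rpowInv x α))

/-- `V ∈ MRV(α, b, μ, ℝ_+^d ∖ C₀)` under the probability measure `P`. -/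
def MRV {Ω : Type*} [MeasurableSpace Ω] (P : Measure Ω) {d : ℕ} (V : Ω → Fin d → ℝ≥0)
    (α : ℝ) (b : ℝ≥0 → ℝ≥0) (μ : Measure (Fin d → ℝ≥0)) (C₀ : Set (Fin d → ℝ≥0)) : Prop :=
  0 ≤ α ∧ RVInv α b ∧ μ ≠ 0 ∧ MTendsto C₀ (fun t => t • P.map fun ω => (b t)⁻¹ • V ω) μ

/-- The canonical scaling function `b_i(t) = F^←(1 - 1/t)`, `t > 1`, where `F` is the distribution
function of `Z^{(i)}` and `F^←(s) = inf {x : s ≤ F x}`. As `Z^{(i)} ≥ 0` and `1 - 1/t > 0`, only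
`x ≥ 0` enter the infimum. -/
def canonicalScale {Ω : Type*} [MeasurableSpace Ω] (P : Measure Ω) {d : ℕ}
    (Z : Ω → Fin d → ℝ≥0) (i : ℕ) (t : ℝ≥0) : ℝ≥0 :=
  sInf {x : ℝ≥0 | 1 - 1 / (t : ℝ) ≤ P.real {ω | ordStat (Z ω) i ≤ x}}

/-- `τ_{q,d}^{(k,i)}(A) = sup_{z ∈ E_d^{(i)}} (A z)^{(k)} / z^{(i)} ∈ [0, ∞]`. -/
def tau {q d : ℕ} (k i : ℕ) (A : Matrix (Fin q) (Fin d) ℝ≥0) : ℝ≥0∞ :=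
  ⨆ z ∈ E d i, ((ordStat (A *ᵥ z) k / ordStat z i : ℝ≥0) : ℝ≥0∞)

/-- `Ω_i^{(k)}`: the event that `i` is the largest `j ∈ {1, …, d}` with `τ_{q,d}^{(k,j)}(A) < ∞`. -/
def OmegaPart {Ω : Type*} {q d : ℕ} (A : Ω → Matrix (Fin q) (Fin d) ℝ≥0) (k i : ℕ) : Set Ω :=
  {ω | IsGreatest {j : ℕ | 1 ≤ j ∧ j ≤ d ∧ tau k j (A ω) < ∞} i}

/-- The pre-image `A^{-1}(C) = {z ∈ ℝ_+^d : A z ∈ C}`. -/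
def preim {q d : ℕ} (A : Matrix (Fin q) (Fin d) ℝ≥0) (C : Set (Fin q → ℝ≥0)) :
    Set (Fin d → ℝ≥0) := {z | A *ᵥ z ∈ C}

/-- `E_i^{(k)}[μ(A^{-1}(C))]`, the expectation over `Ω_i^{(k)}`. -/
def meanMass {Ω : Type*} [MeasurableSpace Ω] (P : Measure Ω) {q d : ℕ}
    (A : Ω → Matrix (Fin q) (Fin d) ℝ≥0) (μ : Measure (Fin d → ℝ≥0)) (k i : ℕ)
    (C : Set (Fin q → ℝ≥0)) : ℝ≥0∞ :=
  ∫⁻ ω in OmegaPart A k i, μ (preim (A ω) C) ∂P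

/-- `C ⊆ E_q^{(k)}` is Borel, bounded away from `CA_q^{(k-1)}`, and `E_i^{(k)}[μ_i(∂A^{-1}(C))] = 0`
for `i = 1, …, d`. The last condition is written as `μ_i(∂A_ω^{-1}(C)) = 0` for almost every
`ω ∈ Ω_i^{(k)}`, because the integrand need not be Borel measurable. -/
def TestSet {Ω : Type*} [MeasurableSpace Ω] (P : Measure Ω) {q d : ℕ}
    (A : Ω → Matrix (Fin q) (Fin d) ℝ≥0) (μ : ℕ → Measure (Fin d → ℝ≥0)) (k : ℕ)
    (C : Set (Fin q → ℝ≥0)) : Prop :=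
  C ⊆ E q k ∧ MeasurableSet C ∧ BoundedAway (CA q (k - 1)) C ∧
    ∀ i ∈ Finset.Icc 1 d, ∀ᵐ ω ∂P, ω ∈ OmegaPart A k i → μ i (frontier (preim (A ω) C)) = 0

end

end Breiman

open Breiman

/-!
Write `T_i(t) = P(Z^{(i)} > t)`. The proof is Breiman's argument, carried out separately on each
event `OmegaPart A k i`.

**Reduction to the tails `T_i`.** The distance of `v` to `CA d (i - 1)` is `ordStat v i`
(`boundedAway_iff`), so being bounded away from the cone is a lower bound on one order statistic.
Since `b i` is the quantile function of `T_i`, one has `b i (1 / T_i(s)) / s → 1`, provided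
`α i > 0`; the index `0` is impossible because the limit measure would carry mass at infinity
(`MRV.index_pos`). Rescaling by factors tending to `1` preserves the convergence
(`TendstoAway.rescale`), whence the laws of `Z / s` divided by `T_i(s)` converge to `μ i`
(`MRV.tendstoAway_scaledLaw`). Regular variation of `b i` also gives the Potter bound
`T_i(s / u) ≤ K u ^ p T_i(s)` for `u ≥ 1` and every `p > α i` (`IsTailQuantile.exists_potter`), and
`T_{i+1}(s) / T_i(s) → 0` from the assumption on the ratios of the scaling functions.

**One part.** On `OmegaPart A k i` the number `tau k i (A ω)` is finite, so `A ω *ᵥ z` can be away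
from `CA q (k - 1)` only if `z` is away from `CA d (i - 1)` (`inv_lt_ordStat`). By independence the
matrix may be fixed; the portmanteau theorem, or the continuity of `f ∘ A ω`, gives convergence for
almost every `ω`, and the Potter bound together with the moment of order `α i + δ` of
`tau k i (A ω)` dominates the integrands (`tendsto_setIntegral_OmegaPart`). The functional
`tau k i` is measurable because it is a supremum of continuous functions of the matrix, hence lower
semicontinuous.

**Sum.** The parts are a partition, since `tau k 1` is always finite. Parts before `i₀` are null and
parts after `i₀` have tails of smaller order, so only `i₀` contributes to the limit
(`tendsto_integral_div_tailProb`). The limit measure is the image of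
`P.restrict (OmegaPart A k i₀) × μ i₀` under `(ω, z) ↦ A ω *ᵥ z`, restricted to `E q k`. It is not
zero: by maximality of `i₀` among the indices with `tau k i (A ω) < ∞`, or, if `i₀ = d`, because
there is no zero row, some face with `i₀` positive coordinates is mapped into `E q k`
(`exists_face_subset_preim`). The scaling function of `A Z` is `b i₀`, for which
`t * T_{i₀}(b i₀ t) → 1`.
-/

namespace Breiman

/-! ### Order statistics -/

/-- The order statistic and the level sets form a Galois connection: every estimate for `ordStat`
below is reduced to counting coordinates by this equivalence. -/
theorem le_ordStat_iff {d : ℕ} (v : Fin d → ℝ≥0) {i : ℕ} (hi : 1 ≤ i) (hid : i ≤ d) (r : ℝ≥0) :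
    r ≤ ordStat v i ↔ i ≤ (Finset.univ.filter fun j => r ≤ v j).card := by
  have key : i ≤ (Finset.univ.filter fun j => ordStat v i ≤ v j).card := by
    rw [ordStat_eq_sort v i hi hid]
    have hm : Monotone (v ∘ Tuple.sort v) := Tuple.monotone_sort v
    have h1 : ((Finset.Ici (⟨d - i, by omega⟩ : Fin d)).map
        (Tuple.sort v).toEmbedding).card = i := by
      rw [Finset.card_map, Fin.card_Ici]
      simp
      omega
    refine h1.symm.le.trans (Finset.card_le_card fun j hj => ?_)
    rw [Finset.mem_map] at hj
    obtain ⟨l, hl, rfl⟩ := hj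
    rw [Finset.mem_Ici] at hl
    simpa using hm hl
  refine ⟨fun h => key.trans (Finset.card_le_card fun j hj => ?_), fun h => ?_⟩
  · rw [Finset.mem_filter] at hj ⊢
    exact ⟨hj.1, h.trans hj.2⟩
  · refine le_csSup ⟨∑ j, v j, fun s hs => ?_⟩ h
    have hpos : 0 < (Finset.univ.filter fun j => s ≤ v j).card := lt_of_lt_of_le hi hs
    obtain ⟨j, hj⟩ := Finset.card_pos.1 hpos
    rw [Finset.mem_filter] at hj
    exact hj.2.trans (Finset.single_le_sum (f := v) (fun _ _ => zero_le) (Finset.mem_univ j))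

theorem ordStat_le_add {d : ℕ} {v w : Fin d → ℝ≥0} {e : ℝ≥0} {i : ℕ} (hi : 1 ≤ i) (hid : i ≤ d)
    (h : ∀ j, v j ≤ w j + e) : ordStat v i ≤ ordStat w i + e := by
  rw [← tsub_le_iff_right, le_ordStat_iff w hi hid]
  refine ((le_ordStat_iff v hi hid _).1 le_rfl).trans (Finset.card_le_card fun j hj => ?_)
  rw [Finset.mem_filter] at hj ⊢
  exact ⟨hj.1, tsub_le_iff_right.2 (hj.2.trans (h j))⟩

theorem ordStat_mono {d : ℕ} {v w : Fin d → ℝ≥0} {i : ℕ} (hi : 1 ≤ i) (hid : i ≤ d)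
    (h : ∀ j, v j ≤ w j) : ordStat v i ≤ ordStat w i := by
  simpa using ordStat_le_add (e := 0) hi hid (by simpa using h)

theorem ordStat_smul {d : ℕ} (c : ℝ≥0) (v : Fin d → ℝ≥0) {i : ℕ} (hi : 1 ≤ i) (hid : i ≤ d) :
    ordStat (c • v) i = c * ordStat v i := by
  rcases eq_or_ne c 0 with rfl | hc
  · rw [zero_smul, zero_mul]
    by_contra h
    have h1 := (le_ordStat_iff (0 : Fin d → ℝ≥0) hi hid _).1 le_rfl
    have h2 : (Finset.univ.filter fun j =>
        ordStat (0 : Fin d → ℝ≥0) i ≤ (0 : Fin d → ℝ≥0) j) = ∅ :=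
      Finset.filter_false_of_mem fun j _ => by simpa using h
    rw [h2, Finset.card_empty] at h1
    omega
  · refine eq_of_forall_le_iff fun r => ?_
    rw [le_ordStat_iff _ hi hid, mul_comm, ← div_le_iff₀ (pos_iff_ne_zero.2 hc),
      le_ordStat_iff _ hi hid]
    have : ∀ j, r ≤ (c • v) j ↔ r / c ≤ v j := fun j => by
      rw [div_le_iff₀ (pos_iff_ne_zero.2 hc), Pi.smul_apply, smul_eq_mul, mul_comm]
    simp_rw [this]

theorem ordStat_const {d : ℕ} (c : ℝ≥0) {i : ℕ} (hi : 1 ≤ i) (hid : i ≤ d) :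
    ordStat (fun _ : Fin d => c) i = c := by
  refine eq_of_forall_le_iff fun r => ?_
  rw [le_ordStat_iff _ hi hid]
  by_cases h : r ≤ c
  · simp [h, hid]
  · simp only [h, Finset.filter_false, Finset.card_empty]
    simp
    omega

theorem ordStat_antitone {d : ℕ} (v : Fin d → ℝ≥0) {i j : ℕ} (hi : 1 ≤ i) (hij : i ≤ j)
    (hjd : j ≤ d) : ordStat v j ≤ ordStat v i := by
  rw [le_ordStat_iff _ hi (hij.trans hjd)]
  exact hij.trans ((le_ordStat_iff v (hi.trans hij) hjd _).1 le_rfl)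

theorem ordStat_pos_iff {d : ℕ} (v : Fin d → ℝ≥0) {i : ℕ} (hi : 1 ≤ i) (hid : i ≤ d) :
    0 < ordStat v i ↔ i ≤ (Finset.univ.filter fun j => 0 < v j).card := by
  refine ⟨fun h => ((le_ordStat_iff v hi hid _).1 le_rfl).trans
    (Finset.card_le_card fun j hj => ?_), fun h => ?_⟩
  · rw [Finset.mem_filter] at hj ⊢
    exact ⟨hj.1, h.trans_le hj.2⟩
  · have hne : (Finset.univ.filter fun j => 0 < v j).Nonempty := Finset.card_pos.1 (by omega)
    obtain ⟨m, hm, hmin⟩ := Finset.exists_min_image _ v hne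
    rw [Finset.mem_filter] at hm
    refine hm.2.trans_le ((le_ordStat_iff v hi hid _).2
      (h.trans (Finset.card_le_card fun j hj => ?_)))
    simpa using hmin j hj

theorem ordStat_le_add_dist {d : ℕ} (v w : Fin d → ℝ≥0) {i : ℕ} (hi : 1 ≤ i) (hid : i ≤ d) :
    (ordStat v i : ℝ) ≤ ordStat w i + dist v w := by
  have := ordStat_le_add (v := v) (w := w) (e := nndist v w) hi hid fun j => by
    have h1 : nndist (v j) (w j) ≤ nndist v w := nndist_le_pi_nndist v w j
    have h2 : dist (v j) (w j) ≤ dist v w := dist_le_pi_dist v w j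
    rw [NNReal.dist_eq] at h2
    rw [← NNReal.coe_le_coe, NNReal.coe_add, coe_nndist]
    linarith [le_abs_self ((v j : ℝ) - w j)]
  rw [← NNReal.coe_le_coe, NNReal.coe_add, coe_nndist] at this
  exact this

theorem continuous_ordStat {d i : ℕ} (hi : 1 ≤ i) (hid : i ≤ d) :
    Continuous fun v : Fin d → ℝ≥0 => ordStat v i := by
  refine (LipschitzWith.of_dist_le_mul (K := 1) fun v w => ?_).continuous
  rw [NNReal.dist_eq, NNReal.coe_one, one_mul, abs_sub_le_iff]
  have h1 := ordStat_le_add_dist v w hi hid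
  have h2 := ordStat_le_add_dist w v hi hid
  rw [dist_comm w v] at h2
  constructor <;> linarith

theorem mem_CA_pred {d i : ℕ} (hi : 1 ≤ i) (v : Fin d → ℝ≥0) :
    v ∈ CA d (i - 1) ↔ ordStat v i = 0 := by
  rw [CA, Set.mem_ofPred_eq, Nat.sub_add_cancel hi]

/-- The distance of `v` to `CA d (i - 1)` is `ordStat v i`: the nearest point is obtained by
lowering every coordinate by `ordStat v i`. -/
theorem boundedAway_iff {d i : ℕ} (hi : 1 ≤ i) (hid : i ≤ d) (B : Set (Fin d → ℝ≥0)) :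
    BoundedAway (CA d (i - 1)) B ↔ ∃ ε : ℝ≥0, 0 < ε ∧ ∀ x ∈ B, ε ≤ ordStat x i := by
  constructor
  · rintro ⟨ε, hε, h⟩
    refine ⟨ε.toNNReal, Real.toNNReal_pos.2 hε, fun x hx => ?_⟩
    rw [Real.toNNReal_le_iff_le_coe]
    let y : Fin d → ℝ≥0 := fun j => x j - ordStat x i
    have hy : y ∈ CA d (i - 1) := by
      rw [mem_CA_pred hi]
      by_contra hne
      have h1 := (ordStat_pos_iff y hi hid).1 (pos_iff_ne_zero.2 hne)
      -- the `i` coordinates of `x` above `ordStat x i` would give a larger `i`-th order statistic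
      have hne' : (Finset.univ.filter fun j => 0 < y j).Nonempty := Finset.card_pos.1 (by omega)
      obtain ⟨m, hm, hmin⟩ := Finset.exists_min_image _ x hne'
      have h2 : x m ≤ ordStat x i := (le_ordStat_iff x hi hid _).2
        (h1.trans (Finset.card_le_card fun j hj => by simpa using hmin j hj))
      rw [Finset.mem_filter] at hm
      exact absurd (tsub_eq_zero_of_le h2) hm.2.ne'
    refine (h x hx y hy).trans ((dist_pi_le_iff (NNReal.coe_nonneg _)).2 fun j => ?_)
    rw [NNReal.dist_eq, abs_sub_le_iff]
    have h3 : y j ≤ x j := tsub_le_self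
    have h4 : x j ≤ y j + ordStat x i := le_tsub_add
    rw [← NNReal.coe_le_coe] at h3 h4
    rw [NNReal.coe_add] at h4
    constructor <;> linarith [NNReal.coe_nonneg (ordStat x i)]
  · rintro ⟨ε, hε, h⟩
    refine ⟨ε, hε, fun x hx y hy => ?_⟩
    have h1 := ordStat_le_add_dist x y hi hid
    rw [(mem_CA_pred hi y).1 hy] at h1
    have h2 : (ε : ℝ) ≤ ordStat x i := h x hx
    simpa using h2.trans h1

/-! ### The functional `tau` -/

variable {q d : ℕ}

theorem continuous_matrix_mulVec (A : Matrix (Fin q) (Fin d) ℝ≥0) :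
    Continuous fun z : Fin d → ℝ≥0 => A *ᵥ z := by
  fun_prop

theorem mulVec_apply_eq_sum (A : Matrix (Fin q) (Fin d) ℝ≥0) (z : Fin d → ℝ≥0) (l : Fin q) :
    (A *ᵥ z) l = ∑ j, A l j * z j := by
  simp [Matrix.mulVec, dotProduct]

theorem mulVec_mono (A : Matrix (Fin q) (Fin d) ℝ≥0) {z w : Fin d → ℝ≥0} (h : ∀ j, z j ≤ w j)
    (l : Fin q) : (A *ᵥ z) l ≤ (A *ᵥ w) l := by
  rw [mulVec_apply_eq_sum, mulVec_apply_eq_sum]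
  exact Finset.sum_le_sum fun j _ => mul_le_mul_right (h j) _

theorem ordStat_mulVec_le_tau {k i : ℕ} (hk : 1 ≤ k) (hkq : k ≤ q) (hi : 1 ≤ i) (hid : i ≤ d)
    (A : Matrix (Fin q) (Fin d) ℝ≥0) (z : Fin d → ℝ≥0) (hA : tau k i A < ∞) :
    ordStat (A *ᵥ z) k ≤ (tau k i A).toNNReal * ordStat z i := by
  have hpos : ∀ z : Fin d → ℝ≥0, 0 < ordStat z i →
      ordStat (A *ᵥ z) k ≤ (tau k i A).toNNReal * ordStat z i := fun z hz => by
    rw [← div_le_iff₀ hz]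
    refine ENNReal.le_toNNReal_of_coe_le ?_ hA.ne
    exact le_iSup₂ (f := fun (z : Fin d → ℝ≥0) (_ : z ∈ E d i) =>
      ((ordStat (A *ᵥ z) k / ordStat z i : ℝ≥0) : ℝ≥0∞)) z hz
  -- on `CA d (i - 1)`, where the quotient is not controlled, approximate `z` by `z + η (1, …, 1)`
  have hlim : Tendsto (fun η : ℝ≥0 => (tau k i A).toNNReal * ordStat (z + fun _ => η) i)
      (𝓝[>] 0) (𝓝 ((tau k i A).toNNReal * ordStat (z + fun _ => 0) i)) := by
    refine Tendsto.mono_left (Continuous.tendsto ?_ 0) nhdsWithin_le_nhds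
    exact continuous_const.mul ((continuous_ordStat hi hid).comp (by fun_prop))
  have hz0 : (z + fun _ => 0) = z := by
    ext
    simp
  rw [hz0] at hlim
  refine ge_of_tendsto hlim ?_
  filter_upwards [self_mem_nhdsWithin] with η hη
  have hη' : 0 < ordStat (z + fun _ => η) i := by
    refine lt_of_lt_of_le (b := ordStat (fun _ : Fin d => η) i) ?_ (ordStat_mono hi hid fun j => ?_)
    · rw [ordStat_const η hi hid]
      exact hη
    · exact le_add_of_nonneg_left zero_le
  exact (ordStat_mono hk hkq (mulVec_mono A fun j => by simp)).trans (hpos _ hη')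

theorem measurable_tau {k i : ℕ} (hk : 1 ≤ k) (hkq : k ≤ q) :
    Measurable fun A : Matrix (Fin q) (Fin d) ℝ≥0 => tau k i A := by
  have h : LowerSemicontinuous fun A : Fin q → Fin d → ℝ≥0 =>
      tau k i (A : Matrix (Fin q) (Fin d) ℝ≥0) := by
    refine lowerSemicontinuous_biSup fun z _ => Continuous.lowerSemicontinuous ?_
    refine ENNReal.continuous_coe.comp (Continuous.div_const ?_ _)
    refine (continuous_ordStat hk hkq).comp (continuous_pi fun l => ?_)
    refine Continuous.congr (f := fun a : Fin q → Fin d → ℝ≥0 => ∑ j, a l j * z j) (by fun_prop)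
      fun a => (mulVec_apply_eq_sum a z l).symm
  exact h.measurable

/-- If no face with `i` positive coordinates is mapped into `E q k`, then `tau k (i + 1) A` is
finite: the part of `z` on its `i` largest coordinates contributes to fewer than `k` rows of
`A *ᵥ z`, and the other coordinates are at most `ordStat z (i + 1)`. -/
theorem tau_succ_lt_top {k i : ℕ} (hk : 1 ≤ k) (hkq : k ≤ q) (hid : i + 1 ≤ d)
    (A : Matrix (Fin q) (Fin d) ℝ≥0)
    (h : ∀ S : Finset (Fin d), S.card = i → ∀ z ∈ face S, ordStat (A *ᵥ z) k = 0) :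
    tau k (i + 1) A < ∞ := by
  let M : ℝ≥0 := ∑ l, ∑ j, A l j
  refine lt_of_le_of_lt (iSup₂_le fun z hz => ?_) (ENNReal.coe_lt_top (r := M))
  have hz' : 0 < ordStat z (i + 1) := hz
  rw [ENNReal.coe_le_coe, div_le_iff₀ hz']
  set s := ordStat z (i + 1) with hs
  -- the coordinates above `s` number at most `i`; complete them to an `i`-element set
  have hcard : (Finset.univ.filter fun j => s < z j).card ≤ i := by
    by_contra hlt
    have hne : (Finset.univ.filter fun j => s < z j).Nonempty := Finset.card_pos.1 (by omega)
    obtain ⟨m, hm, hmin⟩ := Finset.exists_min_image _ z hne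
    have h2 : z m ≤ s := (le_ordStat_iff z (by omega) hid _).2
      ((not_le.1 hlt).trans_le (Finset.card_le_card fun j hj => by simpa using hmin j hj))
    rw [Finset.mem_filter] at hm
    exact absurd h2 (not_le.2 hm.2)
  obtain ⟨S, hTS, hS⟩ := Finset.exists_superset_card_eq hcard (by simp; omega)
  have hx := h S hS (fun j => if j ∈ S then 1 else 0) fun j => by
    by_cases hj : j ∈ S <;> simp [hj]
  have hrow : ∀ l, (A *ᵥ fun j => if j ∈ S then 1 else 0) l = 0 → (A *ᵥ z) l ≤ M * s := by
    intro l hl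
    have hzero : ∀ j ∈ S, A l j = 0 := fun j hj => by
      rw [mulVec_apply_eq_sum] at hl
      have := (Finset.sum_eq_zero_iff.1 hl) j (Finset.mem_univ j)
      simpa [hj] using this
    calc (A *ᵥ z) l = ∑ j, A l j * z j := mulVec_apply_eq_sum ..
      _ ≤ ∑ j, A l j * s := Finset.sum_le_sum fun j _ => by
          by_cases hj : j ∈ S
          · simp [hzero j hj]
          · have : z j ≤ s := not_lt.1 fun hlt => hj (hTS (by simpa using hlt))
            gcongr
      _ = (∑ j, A l j) * s := (Finset.sum_mul ..).symm
      _ ≤ M * s := by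
          gcongr
          exact Finset.single_le_sum (f := fun l => ∑ j, A l j) (fun _ _ => zero_le)
            (Finset.mem_univ l)
  by_contra hlt
  rw [not_le] at hlt
  refine absurd hx (ne_of_gt ((ordStat_pos_iff _ hk hkq).2
    (((le_ordStat_iff (A *ᵥ z) hk hkq _).1 le_rfl).trans (Finset.card_le_card fun l hl => ?_))))
  rw [Finset.mem_filter] at hl ⊢
  refine ⟨hl.1, pos_iff_ne_zero.2 fun h0 => ?_⟩
  exact absurd (hl.2.trans (hrow l h0)) (not_le.2 hlt)

theorem tau_one_lt_top {k : ℕ} (hk : 1 ≤ k) (hkq : k ≤ q) (hd : 1 ≤ d)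
    (A : Matrix (Fin q) (Fin d) ℝ≥0) : tau k 1 A < ∞ := by
  refine tau_succ_lt_top (i := 0) hk hkq hd A fun S hS z hz => ?_
  have hz0 : z = 0 := by
    ext j
    have := (hz j).not
    rw [Finset.card_eq_zero.1 hS] at this
    simpa using this
  rw [hz0, Matrix.mulVec_zero]
  simpa using ordStat_smul (0 : ℝ≥0) (0 : Fin q → ℝ≥0) hk hkq

/-- `face S ⊆ A⁻¹(E q k)` as soon as some point of `face S` is mapped into `E q k`. -/
theorem face_subset_preim {k : ℕ} (hk : 1 ≤ k) (hkq : k ≤ q) (A : Matrix (Fin q) (Fin d) ℝ≥0)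
    {S : Finset (Fin d)} {z : Fin d → ℝ≥0} (hz : z ∈ face S) (hzk : 0 < ordStat (A *ᵥ z) k) :
    face S ⊆ preim A (E q k) := by
  intro w hw
  refine (ordStat_pos_iff _ hk hkq).2 (((ordStat_pos_iff _ hk hkq).1 hzk).trans
    (Finset.card_le_card fun l hl => ?_))
  rw [Finset.mem_filter] at hl ⊢
  refine ⟨hl.1, ?_⟩
  rw [mulVec_apply_eq_sum] at hl ⊢
  obtain ⟨j, -, hj⟩ := Finset.exists_ne_zero_of_sum_ne_zero hl.2.ne'
  have hA : A l j ≠ 0 := left_ne_zero_of_mul hj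
  have hwj : 0 < w j := (hw j).2 ((hz j).1 (pos_iff_ne_zero.2 (right_ne_zero_of_mul hj)))
  exact (mul_pos (pos_iff_ne_zero.2 hA) hwj).trans_le (Finset.single_le_sum
    (f := fun j => A l j * w j) (fun _ _ => zero_le) (Finset.mem_univ j))

/-- If `i` is the largest index with `tau k i A < ∞`, some face with `i` positive coordinates is
mapped into `E q k`. -/
theorem exists_face_subset_preim {k i : ℕ} (hk : 1 ≤ k) (hkq : k ≤ q)
    (A : Matrix (Fin q) (Fin d) ℝ≥0) (hrow : ∀ l, A l ≠ 0)
    (hi : IsGreatest {j : ℕ | 1 ≤ j ∧ j ≤ d ∧ tau k j A < ∞} i) :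
    ∃ S : Finset (Fin d), S.card = i ∧ face S ⊆ preim A (E q k) := by
  obtain ⟨⟨h1, hid, hfin⟩, hmax⟩ := hi
  rcases hid.lt_or_eq with hlt | rfl
  · by_contra hno
    push Not at hno
    have htau : tau k (i + 1) A < ∞ := tau_succ_lt_top hk hkq hlt A fun S hS z hz => by
      by_contra hne
      exact hno S hS (face_subset_preim hk hkq A hz (pos_iff_ne_zero.2 hne))
    have := hmax ⟨by omega, hlt, htau⟩
    omega
  · refine ⟨Finset.univ, by simp,
      face_subset_preim hk hkq A (z := fun _ => 1) (fun j => by simp) ?_⟩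
    rw [ordStat_pos_iff _ hk hkq]
    have : (Finset.univ.filter fun l => 0 < (A *ᵥ fun _ => (1 : ℝ≥0)) l) = Finset.univ := by
      refine Finset.filter_true_of_mem fun l _ => pos_iff_ne_zero.2 fun h0 => hrow l ?_
      ext j
      rw [mulVec_apply_eq_sum] at h0
      have := (Finset.sum_eq_zero_iff.1 h0) j (Finset.mem_univ j)
      simpa using this
    rw [this]
    simpa using hkq

/-! ### Regularly varying tails and their quantile functions -/

/-- `b` is a quantile function of the tail `T`: `b t` is the level at which `T` crosses `1 / t`.
No continuity of `T` is assumed, hence no statement about `T (b t)` itself. -/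
structure IsTailQuantile (T b : ℝ≥0 → ℝ≥0) : Prop where
  antitone : Antitone T
  tendsto_zero : Tendsto T atTop (𝓝 0)
  le_of_tail_le : ∀ {t x : ℝ≥0}, 0 < t → T x ≤ t⁻¹ → b t ≤ x
  tail_le_of_lt : ∀ {t x : ℝ≥0}, 0 < t → b t < x → T x ≤ t⁻¹

theorem one_lt_rpowInv {α : ℝ} (hα : 0 ≤ α) {x : ℝ≥0} (hx : 1 < x) : 1 < rpowInv x α := by
  unfold rpowInv
  split_ifs with h0 h1 h2
  · exact absurd hx h1.not_gt
  · exact absurd hx h2.le.not_gt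
  · simp
  · exact_mod_cast NNReal.one_lt_rpow hx (by have := lt_of_le_of_ne hα (Ne.symm h0); positivity)

theorem rpowInv_lt_one {α : ℝ} (hα : 0 ≤ α) {x : ℝ≥0} (hx : x < 1) : rpowInv x α < 1 := by
  unfold rpowInv
  split_ifs with h0
  · simp
  · exact_mod_cast NNReal.rpow_lt_one hx (by have := lt_of_le_of_ne hα (Ne.symm h0); positivity)

theorem rpowInv_two_rpow_neg_lt {α p : ℝ} (hα : 0 ≤ α) (hp : α < p) :
    rpowInv ((2 : ℝ≥0) ^ (-p)) α < ((2⁻¹ : ℝ≥0) : ℝ≥0∞) := by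
  unfold rpowInv
  split_ifs with h0 h1 h2
  · simp
  · exact absurd (NNReal.rpow_lt_one_of_one_lt_of_neg one_lt_two (by linarith)) h1
  · exact absurd (NNReal.rpow_lt_one_of_one_lt_of_neg one_lt_two (by linarith)) h1
  · have hα' : 0 < α := lt_of_le_of_ne hα (Ne.symm h0)
    rw [ENNReal.coe_lt_coe, ← NNReal.rpow_mul, ← NNReal.rpow_neg_one]
    refine NNReal.rpow_lt_rpow_of_exponent_lt one_lt_two ?_
    rw [mul_one_div, div_lt_iff₀ hα']
    linarith

theorem RVInv.eventually_mul_lt {α : ℝ} {b : ℝ≥0 → ℝ≥0} (hb : RVInv α b) {x c : ℝ≥0} (hx : 0 < x)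
    (hc : (c : ℝ≥0∞) < rpowInv x α) : ∀ᶠ t in atTop, c * b t < b (t * x) := by
  filter_upwards [(hb.2.2 x hx).eventually_const_lt hc, hb.2.1] with t ht h0
  exact (lt_div_iff₀ h0).1 (ENNReal.coe_lt_coe.1 ht)

theorem RVInv.eventually_lt_mul {α : ℝ} {b : ℝ≥0 → ℝ≥0} (hb : RVInv α b) {x c : ℝ≥0} (hx : 0 < x)
    (hc : rpowInv x α < (c : ℝ≥0∞)) : ∀ᶠ t in atTop, b (t * x) < c * b t := by
  filter_upwards [(hb.2.2 x hx).eventually_lt_const hc, hb.2.1] with t ht h0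
  exact (div_lt_iff₀ h0).1 (ENNReal.coe_lt_coe.1 ht)

namespace IsTailQuantile

variable {T b : ℝ≥0 → ℝ≥0} {α : ℝ}

theorem mono (h : IsTailQuantile T b) {t t' : ℝ≥0} (ht : 0 < t) (htt : t ≤ t') : b t ≤ b t' := by
  refine le_of_forall_gt_imp_ge_of_dense fun x hx => h.le_of_tail_le ht ?_
  exact (h.tail_le_of_lt (ht.trans_le htt) hx).trans (inv_anti₀ ht htt)

theorem tendsto_quantile (h : IsTailQuantile T b) (hα : 0 ≤ α) (hb : RVInv α b) :
    Tendsto b atTop atTop := by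
  obtain ⟨c, hc1, hc⟩ := ENNReal.lt_iff_exists_nnreal_btwn.1 (one_lt_rpowInv hα one_lt_two)
  have hc1' : 1 < c := by exact_mod_cast hc1
  obtain ⟨t₀, ht₀⟩ := eventually_atTop.1
    ((hb.eventually_mul_lt two_pos hc).and (hb.2.1.and (eventually_gt_atTop 0)))
  have hpow : ∀ n : ℕ, c ^ n * b t₀ ≤ b (t₀ * 2 ^ n) := by
    intro n
    induction n with
    | zero => simp
    | succ n ih =>
      have h1 := (ht₀ (t₀ * 2 ^ n) (le_mul_of_one_le_right' (one_le_pow₀ one_le_two))).1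
      calc c ^ (n + 1) * b t₀ = c * (c ^ n * b t₀) := by ring
        _ ≤ c * b (t₀ * 2 ^ n) := by gcongr
        _ ≤ b (t₀ * 2 ^ n * 2) := h1.le
        _ = b (t₀ * 2 ^ (n + 1)) := by ring_nf
  refine tendsto_atTop.2 fun M => ?_
  obtain ⟨n, hn⟩ := pow_unbounded_of_one_lt (M / b t₀) hc1'
  have hb0 := (ht₀ t₀ le_rfl).2.1
  have ht0 := (ht₀ t₀ le_rfl).2.2
  filter_upwards [eventually_ge_atTop (t₀ * 2 ^ n)] with t ht
  exact ((div_lt_iff₀ hb0).1 hn).le.trans ((hpow n).trans (h.mono (by positivity) ht))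

theorem tail_pos (h : IsTailQuantile T b) (hα : 0 ≤ α) (hb : RVInv α b) (s : ℝ≥0) : 0 < T s := by
  by_contra h0
  have h0' : T s = 0 := by simpa using h0
  obtain ⟨t, ht, ht0⟩ := (((h.tendsto_quantile hα hb).eventually_gt_atTop s).and
    (eventually_gt_atTop 0)).exists
  exact absurd (h.le_of_tail_le ht0 (h0' ▸ zero_le)) (not_le.2 ht)

theorem tendsto_inv_tail (h : IsTailQuantile T b) (hα : 0 ≤ α) (hb : RVInv α b) :
    Tendsto (fun s => (T s)⁻¹) atTop atTop := by
  refine tendsto_atTop.2 fun M => ?_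
  have hM : 0 < (M + 1)⁻¹ := by positivity
  filter_upwards [h.tendsto_zero.eventually_lt_const hM] with s hs
  have := (inv_le_inv₀ hM (h.tail_pos hα hb s)).2 hs.le
  rw [inv_inv] at this
  exact (le_add_of_nonneg_right zero_le).trans this

theorem quantile_inv_tail_le (h : IsTailQuantile T b) {s : ℝ≥0} (hs : 0 < T s) :
    b (T s)⁻¹ ≤ s :=
  h.le_of_tail_le (by positivity) (by rw [inv_inv])

theorem le_quantile_inv_tail_mul (h : IsTailQuantile T b) {s x : ℝ≥0} (hs : 0 < T s) (hx : 1 < x) :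
    s ≤ b ((T s)⁻¹ * x) := by
  by_contra hlt
  have h1 := h.tail_le_of_lt (by positivity) (not_le.1 hlt)
  rw [mul_inv, inv_inv] at h1
  exact absurd h1 (not_le.2 (mul_lt_of_lt_one_right hs (inv_lt_one_of_one_lt₀ hx)))

/-- The quantile at level `1 / T s` is asymptotically `s`. -/
theorem tendsto_quantile_inv_tail_div (h : IsTailQuantile T b) (hα : 0 < α) (hb : RVInv α b) :
    Tendsto (fun s => b (T s)⁻¹ / s) atTop (𝓝 1) := by
  have hT := h.tail_pos hα.le hb
  refine tendsto_order.2 ⟨fun a ha => ?_, fun a ha => ?_⟩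
  · rcases eq_or_ne a 0 with rfl | ha0
    · filter_upwards [(h.tendsto_inv_tail hα.le hb).eventually hb.2.1, eventually_gt_atTop 0]
        with s h1 h2
      positivity
    have ha0' := pos_iff_ne_zero.2 ha0
    obtain ⟨m, hm1, hm⟩ := exists_between ((one_lt_inv₀ ha0').2 ha)
    have hlim : rpowInv (m ^ α) α < ((a⁻¹ : ℝ≥0) : ℝ≥0∞) := by
      rw [rpowInv, if_neg hα.ne', ← NNReal.rpow_mul, mul_one_div_cancel hα.ne', NNReal.rpow_one]
      exact_mod_cast hm
    have hm0 : 0 < m := zero_lt_one.trans hm1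
    filter_upwards [(h.tendsto_inv_tail hα.le hb).eventually
      (hb.eventually_lt_mul (NNReal.rpow_pos hm0) hlim), eventually_gt_atTop 0] with s hs hs0
    rw [lt_div_iff₀ hs0]
    have h1 := (h.le_quantile_inv_tail_mul (hT s) (NNReal.one_lt_rpow hm1 hα)).trans_lt hs
    rwa [inv_mul_eq_div, lt_div_iff₀ ha0', mul_comm] at h1
  · filter_upwards [eventually_gt_atTop 0] with s hs
    exact (div_le_one_of_le₀ (h.quantile_inv_tail_le (hT s)) zero_le).trans_lt ha

theorem eventually_tail_half_le (h : IsTailQuantile T b) (hα : 0 ≤ α) (hb : RVInv α b) {p : ℝ}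
    (hp : α < p) : ∀ᶠ s in atTop, T (s / 2) ≤ 2 ^ p * T s := by
  have hT := h.tail_pos hα hb
  have h2 : (0 : ℝ≥0) < 2 ^ (-p) := NNReal.rpow_pos two_pos
  filter_upwards [(h.tendsto_inv_tail hα hb).eventually
    (hb.eventually_lt_mul h2 (rpowInv_two_rpow_neg_lt hα hp))] with s hs
  have hT' := hT s
  have h1 : b ((T s)⁻¹ * 2 ^ (-p)) < s / 2 := hs.trans_le (by
    rw [div_eq_inv_mul]
    gcongr
    exact h.quantile_inv_tail_le (hT s))
  have h3 := h.tail_le_of_lt (by positivity) h1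
  rwa [mul_inv, inv_inv, NNReal.rpow_neg, inv_inv, mul_comm] at h3

/-- A Potter bound. -/
theorem exists_potter (h : IsTailQuantile T b) (hα : 0 ≤ α) (hb : RVInv α b) {p : ℝ}
    (hp : α < p) : ∃ K s₀ : ℝ≥0, ∀ s, s₀ ≤ s → ∀ u, 1 ≤ u → T (s / u) ≤ K * u ^ p * T s := by
  obtain ⟨s₀, hs₀⟩ := eventually_atTop.1 (h.eventually_tail_half_le hα hb hp)
  have hT := h.tail_pos hα hb
  set K := T 0 / T (2 * s₀) with hK
  have hK1 : 1 ≤ K := (one_le_div (hT _)).2 (h.antitone zero_le)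
  have h2p : (1 : ℝ≥0) ≤ 2 ^ p := NNReal.one_le_rpow one_le_two (hα.trans hp.le)
  have hdyadic : ∀ (n : ℕ) (s : ℝ≥0), s₀ ≤ s → T (s / 2 ^ n) ≤ K * (2 ^ p) ^ n * T s := by
    intro n
    induction n with
    | zero =>
      intro s _
      simpa using le_mul_of_one_le_left' hK1
    | succ n ih =>
      intro s hs
      rcases le_or_gt s₀ (s / 2) with hle | hlt
      · calc T (s / 2 ^ (n + 1)) = T (s / 2 / 2 ^ n) := by rw [div_div, pow_succ']
          _ ≤ K * (2 ^ p) ^ n * T (s / 2) := ih _ hle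
          _ ≤ K * (2 ^ p) ^ n * (2 ^ p * T s) := by
            gcongr
            exact hs₀ s hs
          _ = K * (2 ^ p) ^ (n + 1) * T s := by ring
      -- once `s / 2 < s₀` the trivial bound by `T 0` is used
      · have hs2 : s ≤ 2 * s₀ := by
          rw [mul_comm]
          exact ((div_lt_iff₀ two_pos).1 hlt).le
        calc T (s / 2 ^ (n + 1)) ≤ T 0 := h.antitone zero_le
          _ = K * 1 * T (2 * s₀) := by rw [hK, mul_one, div_mul_cancel₀ _ (hT _).ne']
          _ ≤ K * (2 ^ p) ^ (n + 1) * T s := by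
            gcongr
            · exact one_le_pow₀ h2p
            · exact h.antitone hs2
  refine ⟨K * 2 ^ p, s₀, fun s hs u hu => ?_⟩
  obtain ⟨n, hn1, hn2⟩ := exists_nat_pow_near hu one_lt_two
  calc T (s / u) ≤ T (s / 2 ^ (n + 1)) := h.antitone (by gcongr)
    _ ≤ K * (2 ^ p) ^ (n + 1) * T s := hdyadic _ s hs
    _ = K * 2 ^ p * (2 ^ n) ^ p * T s := by
      rw [pow_succ', ← NNReal.rpow_natCast, ← NNReal.rpow_mul, ← NNReal.rpow_natCast,
        ← NNReal.rpow_mul, mul_comm p]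
      ring
    _ ≤ K * 2 ^ p * u ^ p * T s := by
      gcongr
      exact hα.trans hp.le

theorem tendsto_mul_tail_quantile (h : IsTailQuantile T b) (hα : 0 ≤ α) (hb : RVInv α b) :
    Tendsto (fun t => t * T (b t)) atTop (𝓝 1) := by
  refine tendsto_order.2 ⟨fun a ha => ?_, fun a ha => ?_⟩
  · rcases eq_or_ne a 0 with rfl | ha0
    · filter_upwards [eventually_gt_atTop 0] with t ht
      exact mul_pos ht (h.tail_pos hα hb _)
    have ha0' := pos_iff_ne_zero.2 ha0
    have hx : 1 < a⁻¹ := (one_lt_inv₀ ha0').2 ha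
    filter_upwards [hb.eventually_mul_lt (c := 1) (inv_pos.2 ha0')
      (by exact_mod_cast one_lt_rpowInv hα hx), eventually_gt_atTop 0] with t ht ht0
    by_contra hle
    refine absurd (h.le_of_tail_le (x := b t) (t := t * a⁻¹) (by positivity) ?_)
      (not_le.2 (by simpa using ht))
    rw [mul_inv, inv_inv, inv_mul_eq_div, le_div_iff₀ ht0, mul_comm]
    exact not_lt.1 hle
  · obtain ⟨m, hm1, hm⟩ := exists_between ha
    have hm0 : 0 < m := zero_lt_one.trans hm1
    filter_upwards [hb.eventually_lt_mul (c := 1) (inv_pos.2 hm0)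
      (by exact_mod_cast rpowInv_lt_one hα (inv_lt_one_of_one_lt₀ hm1)), eventually_gt_atTop 0]
      with t ht ht0
    rw [one_mul] at ht
    have h1 := h.tail_le_of_lt (by positivity) ht
    rw [mul_inv, inv_inv, inv_mul_eq_div, le_div_iff₀ ht0, mul_comm] at h1
    exact h1.trans_lt hm

/-- If the quantiles `b` dominate the quantiles `b'`, the tail `T` dominates the tail `T'`. -/
theorem tendsto_tail_div_tail {T' b' : ℝ≥0 → ℝ≥0} {α' : ℝ} (h : IsTailQuantile T b)
    (h' : IsTailQuantile T' b') (hα : 0 ≤ α) (hb : RVInv α b) (hα' : 0 < α') (hb' : RVInv α' b')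
    (hbb : Tendsto (fun t => b t / b' t) atTop atTop) :
    Tendsto (fun s => T' s / T s) atTop (𝓝 0) := by
  have hT := h.tail_pos hα hb
  refine tendsto_order.2 ⟨fun a ha => absurd ha not_lt_zero, fun a ha => ?_⟩
  obtain ⟨e, he0, he⟩ := exists_between ha
  have hlim : rpowInv e⁻¹ α' < ((e⁻¹ ^ (1 / α') + 1 : ℝ≥0) : ℝ≥0∞) := by
    rw [rpowInv, if_neg hα'.ne', ENNReal.coe_lt_coe]
    exact lt_add_one _
  filter_upwards [(h.tendsto_inv_tail hα hb).eventually
    ((hb'.eventually_lt_mul (inv_pos.2 he0) hlim).and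
      ((hbb.eventually_ge_atTop (e⁻¹ ^ (1 / α') + 1)).and hb'.2.1))] with s hs
  obtain ⟨h1, h2, h3⟩ := hs
  have hTs := hT s
  have h4 : b' ((T s)⁻¹ * e⁻¹) < s :=
    h1.trans_le (((le_div_iff₀ h3).1 h2).trans (h.quantile_inv_tail_le hTs))
  have h5 := h'.tail_le_of_lt (by positivity) h4
  rw [mul_inv, inv_inv, inv_inv, mul_comm] at h5
  exact ((div_le_iff₀ hTs).2 h5).trans_lt he

end IsTailQuantile

/-! ### Convergence of measures away from a cone -/

/-- Convergence of the integrals of all test functions of `MTendsto`, along an arbitrary filter. -/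
def TendstoAway {d : ℕ} {ι : Type*} (C₀ : Set (Fin d → ℝ≥0)) (ν : ι → Measure (Fin d → ℝ≥0))
    (l : Filter ι) (μ : Measure (Fin d → ℝ≥0)) : Prop :=
  ∀ f : (Fin d → ℝ≥0) →ᵇ ℝ, BoundedAway C₀ (Function.support f) →
    Tendsto (fun t => ∫ x, f x ∂(ν t)) l (𝓝 (∫ x, f x ∂μ))

section

variable {d i : ℕ} {μ : Measure (Fin d → ℝ≥0)}

theorem measurable_ordStat (hi : 1 ≤ i) (hid : i ≤ d) :
    Measurable fun v : Fin d → ℝ≥0 => ordStat v i :=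
  (continuous_ordStat hi hid).measurable

theorem InM.measure_le_ordStat_lt_top (hi : 1 ≤ i) (hid : i ≤ d) (hμ : InM (CA d (i - 1)) μ)
    {ε : ℝ≥0} (hε : 0 < ε) : μ {x | ε ≤ ordStat x i} < ∞ :=
  hμ.2 _ (measurableSet_le measurable_const (measurable_ordStat hi hid))
    ((boundedAway_iff hi hid _).2 ⟨ε, hε, fun _ hx => hx⟩)

theorem InM.sigmaFinite (hi : 1 ≤ i) (hid : i ≤ d) (hμ : InM (CA d (i - 1)) μ) :
    SigmaFinite μ := by
  refine ⟨⟨⟨fun n => {x | ((n : ℝ≥0) + 1)⁻¹ ≤ ordStat x i} ∪ CA d (i - 1), fun _ => trivial,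
    fun n => ?_, Set.eq_univ_of_forall fun x => ?_⟩⟩⟩
  · refine (measure_union_le _ _).trans_lt ?_
    rw [hμ.1, add_zero]
    exact hμ.measure_le_ordStat_lt_top hi hid (by positivity)
  · rw [Set.mem_iUnion]
    rcases eq_or_ne (ordStat x i) 0 with h0 | h0
    · exact ⟨0, Or.inr ((mem_CA_pred hi x).2 h0)⟩
    · obtain ⟨n, hn⟩ := exists_nat_ge (ordStat x i)⁻¹
      refine ⟨n, Or.inl ?_⟩
      rw [Set.mem_ofPred_eq, inv_le_comm₀ (by positivity) (pos_iff_ne_zero.2 h0)]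
      exact hn.trans (le_add_of_nonneg_right zero_le)

theorem InM.integrable (hi : 1 ≤ i) (hid : i ≤ d) (hμ : InM (CA d (i - 1)) μ)
    {g : (Fin d → ℝ≥0) → ℝ} (hg : Measurable g) {M : ℝ} (hM : ∀ x, |g x| ≤ M)
    {ε : ℝ≥0} (hε : 0 < ε) (hsupp : ∀ x, g x ≠ 0 → ε ≤ ordStat x i) : Integrable g μ := by
  rw [← integrableOn_iff_integrable_of_support_subset (s := {x | ε ≤ ordStat x i}) hsupp]
  exact Measure.integrableOn_of_bounded (hμ.measure_le_ordStat_lt_top hi hid hε).ne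
    hg.aestronglyMeasurable (Eventually.of_forall hM)

/-- A continuous function of `ordStat x i` which vanishes where `ordStat x i ≤ r / 2` and is `1`
where `r ≤ ordStat x i`. -/
noncomputable def cutoff {d : ℕ} (i : ℕ) (r : ℝ≥0) (x : Fin d → ℝ≥0) : ℝ≥0 :=
  min 1 (ordStat x i * (2 / r) - 1)

theorem continuous_cutoff (hi : 1 ≤ i) (hid : i ≤ d) (r : ℝ≥0) :
    Continuous fun x : Fin d → ℝ≥0 => cutoff i r x := by
  have := continuous_ordStat hi hid
  unfold cutoff
  fun_prop

theorem cutoff_le_one (r : ℝ≥0) (x : Fin d → ℝ≥0) : cutoff i r x ≤ 1 := min_le_left _ _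

theorem cutoff_eq_one {r : ℝ≥0} (hr : 0 < r) {x : Fin d → ℝ≥0} (hx : r ≤ ordStat x i) :
    cutoff i r x = 1 := by
  refine min_eq_left (le_tsub_of_add_le_right ?_)
  calc (1 : ℝ≥0) + 1 = r * (2 / r) := by rw [mul_div_cancel₀ _ hr.ne', one_add_one_eq_two]
    _ ≤ ordStat x i * (2 / r) := by gcongr

theorem lt_ordStat_of_cutoff_ne_zero {r : ℝ≥0} (hr : 0 < r) {x : Fin d → ℝ≥0}
    (hx : cutoff i r x ≠ 0) : r / 2 < ordStat x i := by
  by_contra hle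
  refine hx (le_antisymm ((min_le_right _ _).trans ?_) zero_le)
  rw [nonpos_iff_eq_zero, tsub_eq_zero_iff_le]
  calc ordStat x i * (2 / r) ≤ r / 2 * (2 / r) := by
        gcongr
        exact not_lt.1 hle
    _ = 1 := by field_simp

/-- `cutoff i r` as a bounded continuous function. -/
noncomputable def cutoffBCF {d i : ℕ} (hi : 1 ≤ i) (hid : i ≤ d) (r : ℝ≥0) :
    (Fin d → ℝ≥0) →ᵇ ℝ :=
  BoundedContinuousFunction.ofNormedAddCommGroup (fun x => (cutoff i r x : ℝ))
    (NNReal.continuous_coe.comp (continuous_cutoff hi hid r)) 1 fun x => by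
      rw [Real.norm_of_nonneg (NNReal.coe_nonneg _)]
      exact_mod_cast cutoff_le_one r x

theorem boundedAway_support_cutoff (hi : 1 ≤ i) (hid : i ≤ d) {r : ℝ≥0} (hr : 0 < r) :
    BoundedAway (CA d (i - 1)) (Function.support (cutoffBCF hi hid r)) := by
  refine (boundedAway_iff hi hid _).2 ⟨r / 2, by positivity, fun x hx => ?_⟩
  refine (lt_ordStat_of_cutoff_ne_zero hr fun h0 => hx ?_).le
  change (cutoff i r x : ℝ) = 0
  rw [h0, NNReal.coe_zero]

theorem measureReal_le_integral_cutoff (hi : 1 ≤ i) (hid : i ≤ d) {r : ℝ≥0} (hr : 0 < r)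
    (hμ : Integrable (cutoffBCF hi hid r) μ) :
    μ.real {x | r ≤ ordStat x i} ≤ ∫ x, cutoffBCF hi hid r x ∂μ := by
  have hm : MeasurableSet {x : Fin d → ℝ≥0 | r ≤ ordStat x i} :=
    measurableSet_le measurable_const (measurable_ordStat hi hid)
  rw [← integral_indicator_one hm]
  refine integral_mono_of_nonneg (Eventually.of_forall fun x => ?_) hμ
    (Eventually.of_forall fun x => ?_)
  · exact Set.indicator_nonneg (fun _ _ => zero_le_one) x
  · refine Set.indicator_le' (fun y hy => ?_) (fun y _ => NNReal.coe_nonneg _) x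
    change (1 : ℝ) ≤ (cutoff i r y : ℝ)
    rw [cutoff_eq_one hr hy, NNReal.coe_one]

theorem integral_cutoff_le_measureReal (hi : 1 ≤ i) (hid : i ≤ d) {r : ℝ≥0} (hr : 0 < r)
    (hμ : μ {x | r / 2 < ordStat x i} ≠ ∞) :
    ∫ x, cutoffBCF hi hid r x ∂μ ≤ μ.real {x | r / 2 < ordStat x i} := by
  have hm : MeasurableSet {x : Fin d → ℝ≥0 | r / 2 < ordStat x i} :=
    measurableSet_lt measurable_const (measurable_ordStat hi hid)
  rw [← integral_indicator_one hm]
  refine integral_mono_of_nonneg (Eventually.of_forall fun x => NNReal.coe_nonneg _)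
    ((integrable_indicator_iff hm).2 (integrableOn_const hμ)) (Eventually.of_forall fun x => ?_)
  change (cutoff i r x : ℝ) ≤ _
  by_cases hx : x ∈ {x : Fin d → ℝ≥0 | r / 2 < ordStat x i}
  · rw [Set.indicator_of_mem hx]
    exact_mod_cast cutoff_le_one r x
  · rw [Set.indicator_of_notMem hx]
    by_contra hne
    exact hx (lt_ordStat_of_cutoff_ne_zero hr fun h0 => hne (by rw [h0, NNReal.coe_zero]))

theorem tendsto_finiteMeasure_of_null_frontier {ι : Type*} {l : Filter ι}
    {m : FiniteMeasure (Fin d → ℝ≥0)} {ms : ι → FiniteMeasure (Fin d → ℝ≥0)}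
    (h : Tendsto ms l (𝓝 m)) {C : Set (Fin d → ℝ≥0)} (hC : m (frontier C) = 0) :
    Tendsto (fun t => ms t C) l (𝓝 (m C)) := by
  rcases eq_or_ne m 0 with rfl | hm
  · have h0 : Tendsto (fun t => (ms t).mass) l (𝓝 0) := by simpa using h.mass
    have : (0 : FiniteMeasure (Fin d → ℝ≥0)) C = 0 := by simp
    rw [this]
    exact tendsto_of_tendsto_of_tendsto_of_le_of_le tendsto_const_nhds h0 (fun _ => zero_le)
      fun t => (ms t).apply_le_mass C
  · have h1 := FiniteMeasure.tendsto_normalize_of_tendsto h hm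
    have h2 := ProbabilityMeasure.tendsto_measure_of_null_frontier_of_tendsto h1 (E := C)
      (by rw [m.normalize_eq_of_nonzero hm, hC, mul_zero])
    simp_rw [FiniteMeasure.self_eq_mass_mul_normalize _ C]
    exact h.mass.mul h2

/-- The part of the portmanteau theorem for `μ`-continuity sets. It is reduced to finite measures by
the density `cutoff i ε`, which equals `1` on `C`. -/
theorem TendstoAway.tendsto_measureReal (hi : 1 ≤ i) (hid : i ≤ d) {ι : Type*} {l : Filter ι}
    {ν : ι → Measure (Fin d → ℝ≥0)} [hν : ∀ t, IsFiniteMeasure (ν t)] (hμ : InM (CA d (i - 1)) μ)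
    (h : TendstoAway (CA d (i - 1)) ν l μ) {C : Set (Fin d → ℝ≥0)} (hCm : MeasurableSet C)
    {ε : ℝ≥0} (hε : 0 < ε) (hC : ∀ x ∈ C, ε ≤ ordStat x i) (hfr : μ (frontier C) = 0) :
    Tendsto (fun t => (ν t).real C) l (𝓝 (μ.real C)) := by
  have hmeas : Measurable fun x : Fin d → ℝ≥0 => cutoff i ε x :=
    (continuous_cutoff hi hid ε).measurable
  have hfin : ∀ ρ : Measure (Fin d → ℝ≥0), ρ {x | ε / 2 ≤ ordStat x i} < ∞ →
      IsFiniteMeasure (ρ.withDensity fun x => (cutoff i ε x : ℝ≥0∞)) := fun ρ hρ => by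
    refine isFiniteMeasure_withDensity (ne_of_lt ?_)
    have hm : MeasurableSet {x : Fin d → ℝ≥0 | ε / 2 ≤ ordStat x i} :=
      measurableSet_le measurable_const (measurable_ordStat hi hid)
    refine lt_of_le_of_lt ?_ hρ
    rw [← lintegral_indicator_one hm]
    refine lintegral_mono fun x => ?_
    by_cases hx : x ∈ {x : Fin d → ℝ≥0 | ε / 2 ≤ ordStat x i}
    · rw [Set.indicator_of_mem hx, Pi.one_apply]
      exact ENNReal.coe_le_one_iff.2 (cutoff_le_one ε x)
    · rw [Set.indicator_of_notMem hx]
      by_contra hne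
      refine hx (lt_ordStat_of_cutoff_ne_zero hε fun h0 => hne ?_).le
      simp [h0]
  let m : FiniteMeasure (Fin d → ℝ≥0) := ⟨μ.withDensity fun x => (cutoff i ε x : ℝ≥0∞),
    hfin μ (hμ.measure_le_ordStat_lt_top hi hid (by positivity))⟩
  let ms : ι → FiniteMeasure (Fin d → ℝ≥0) := fun t =>
    ⟨(ν t).withDensity fun x => (cutoff i ε x : ℝ≥0∞), hfin (ν t) (measure_lt_top _ _)⟩
  have hlim : Tendsto ms l (𝓝 m) := by
    refine FiniteMeasure.tendsto_iff_forall_integral_tendsto.2 fun f => ?_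
    change Tendsto (fun t => ∫ x, f x ∂(ν t).withDensity fun x => (cutoff i ε x : ℝ≥0∞)) l
      (𝓝 (∫ x, f x ∂μ.withDensity fun x => (cutoff i ε x : ℝ≥0∞)))
    simp_rw [integral_withDensity_eq_integral_smul hmeas]
    obtain ⟨r, hr, hr'⟩ := boundedAway_support_cutoff hi hid hε
    exact h (cutoffBCF hi hid ε * f) ⟨r, hr, fun x hx y hy => hr' x (left_ne_zero_of_mul hx) y hy⟩
  have hval : ∀ ρ : Measure (Fin d → ℝ≥0),
      (ρ.withDensity fun x => (cutoff i ε x : ℝ≥0∞)) C = ρ C := fun ρ => by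
    rw [withDensity_apply _ hCm, setLIntegral_congr_fun hCm
      (g := fun _ => 1) (fun x hx => by rw [cutoff_eq_one hε (hC x hx), ENNReal.coe_one])]
    simp
  have hfr' : m (frontier C) = 0 := by
    rw [FiniteMeasure.null_iff_toMeasure_null]
    exact withDensity_absolutelyContinuous _ _ hfr
  have key := (NNReal.continuous_coe.tendsto _).comp
    (tendsto_finiteMeasure_of_null_frontier hlim hfr')
  have e1 : ((m C : ℝ≥0) : ℝ) = μ.real C := congrArg ENNReal.toReal (hval μ)
  have e2 : ∀ t, ((ms t C : ℝ≥0) : ℝ) = (ν t).real C := fun t =>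
    congrArg ENNReal.toReal (hval (ν t))
  rw [e1] at key
  exact key.congr e2

theorem continuous_nnreal_smul : Continuous fun p : (Fin d → ℝ≥0) × ℝ≥0 => p.2 • p.1 := by
  refine continuous_pi fun j => ?_
  simp only [Pi.smul_apply, smul_eq_mul]
  fun_prop

/-- Test-function convergence is stable under rescaling by factors tending to `1`. The test
functions need not be uniformly continuous under scaling; the error is bounded by the modulus
`sup {|f (c • x) - f x| : |c - 1| ≤ 1 / (n + 1)}`, itself a test function. -/
theorem TendstoAway.rescale (hi : 1 ≤ i) (hid : i ≤ d) {ι : Type*} {l : Filter ι}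
    {ν : ι → Measure (Fin d → ℝ≥0)} [hν : ∀ t, IsFiniteMeasure (ν t)] (hμ : InM (CA d (i - 1)) μ)
    (h : TendstoAway (CA d (i - 1)) ν l μ) {c : ι → ℝ≥0} (hc : Tendsto c l (𝓝 1))
    (f : (Fin d → ℝ≥0) →ᵇ ℝ) (hf : BoundedAway (CA d (i - 1)) (Function.support f)) :
    Tendsto (fun t => ∫ x, f (c t • x) ∂(ν t)) l (𝓝 (∫ x, f x ∂μ)) := by
  obtain ⟨ε, hε, hsupp⟩ := (boundedAway_iff hi hid _).1 hf
  let K : ℕ → Set ℝ≥0 := fun n => Metric.closedBall 1 (1 / ((n : ℝ) + 1))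
  have hKc : ∀ n, IsCompact (K n) := fun n => isCompact_closedBall _ _
  have h1K : ∀ n, (1 : ℝ≥0) ∈ K n := fun n => Metric.mem_closedBall_self (by positivity)
  have hK2 : ∀ n, ∀ a ∈ K n, a ≤ 2 := fun n a ha => by
    have h1 : dist a 1 ≤ 1 / ((n : ℝ) + 1) := ha
    have h2 : 1 / ((n : ℝ) + 1) ≤ 1 := by
      rw [div_le_one (by positivity)]
      linarith [(Nat.cast_nonneg n : (0 : ℝ) ≤ n)]
    rw [NNReal.dist_eq, abs_sub_le_iff] at h1
    have h3 : (a : ℝ) ≤ 2 := by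
      have := h1.1
      rw [NNReal.coe_one] at this
      linarith
    exact_mod_cast h3
  let D : (Fin d → ℝ≥0) → ℝ≥0 → ℝ := fun x a => |f (a • x) - f x|
  have hD : Continuous ↿D := by
    have h1 : Continuous fun p : (Fin d → ℝ≥0) × ℝ≥0 => f (p.2 • p.1) :=
      f.continuous.comp continuous_nnreal_smul
    exact (h1.sub (f.continuous.comp continuous_fst)).abs
  have hDx : ∀ x, Continuous (D x) := fun x => hD.comp (by fun_prop : Continuous fun a => (x, a))
  let G : ℕ → (Fin d → ℝ≥0) → ℝ := fun n x => sSup (D x '' K n)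
  have hG : ∀ n, Continuous (G n) := fun n => (hKc n).continuous_sSup hD
  have hDG : ∀ n x a, a ∈ K n → D x a ≤ G n x := fun n x a ha =>
    le_csSup ((hKc n).bddAbove_image (hDx x).continuousOn) (Set.mem_image_of_mem _ ha)
  have hG0 : ∀ n x, 0 ≤ G n x := fun n x => (abs_nonneg _).trans (hDG n x 1 (h1K n))
  have hGle : ∀ n x (r : ℝ), (∀ a ∈ K n, D x a ≤ r) → G n x ≤ r := fun n x r hr =>
    csSup_le ((Set.nonempty_of_mem (h1K n)).image _) (Set.forall_mem_image.2 hr)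
  have hGM : ∀ n x, |G n x| ≤ 2 * ‖f‖ := fun n x => by
    rw [abs_of_nonneg (hG0 n x)]
    refine hGle n x _ fun a _ => ?_
    have h1 := f.norm_coe_le_norm (a • x)
    have h2 := f.norm_coe_le_norm x
    calc |f (a • x) - f x| ≤ ‖f (a • x)‖ + ‖f x‖ := by
          simpa only [Real.norm_eq_abs] using norm_sub_le (f (a • x)) (f x)
      _ ≤ 2 * ‖f‖ := by linarith
  have hGsupp : ∀ n x, G n x ≠ 0 → ε / 2 ≤ ordStat x i := fun n x hx => by
    by_contra hlt
    rw [not_le, lt_div_iff₀ two_pos] at hlt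
    have hz : ∀ a ≤ (2 : ℝ≥0), f (a • x) = 0 := fun a ha => by
      by_contra hne
      have h1 := hsupp _ hne
      rw [ordStat_smul _ _ hi hid, mul_comm] at h1
      exact absurd (h1.trans (mul_le_mul_right ha _)) (not_le.2 hlt)
    refine hx (le_antisymm (hGle n x 0 fun a ha => ?_) (hG0 n x))
    have h1 := hz 1 one_le_two
    rw [one_smul] at h1
    simp [D, hz a (hK2 n a ha), h1]
  let GB : ℕ → (Fin d → ℝ≥0) →ᵇ ℝ := fun n =>
    BoundedContinuousFunction.ofNormedAddCommGroup (G n) (hG n) (2 * ‖f‖) (hGM n)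
  have hGB : ∀ n, BoundedAway (CA d (i - 1)) (Function.support (GB n)) := fun n =>
    (boundedAway_iff hi hid _).2 ⟨ε / 2, by positivity, fun x hx => hGsupp n x hx⟩
  have hGlim : Tendsto (fun n => ∫ x, G n x ∂μ) atTop (𝓝 0) := by
    have hm : MeasurableSet {x : Fin d → ℝ≥0 | ε / 2 ≤ ordStat x i} :=
      measurableSet_le measurable_const (measurable_ordStat hi hid)
    have hint : Integrable ({x : Fin d → ℝ≥0 | ε / 2 ≤ ordStat x i}.indicator
        fun _ => 2 * ‖f‖) μ := (integrable_indicator_iff hm).2 (integrableOn_const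
      (hμ.measure_le_ordStat_lt_top hi hid (by positivity)).ne)
    have := tendsto_integral_of_dominated_convergence (μ := μ) (F := G) (f := fun _ => (0 : ℝ)) _
      (fun n => (hG n).aestronglyMeasurable) hint
      (fun n => Eventually.of_forall fun x => ?_) (Eventually.of_forall fun x => ?_)
    · simpa using this
    · by_cases hx : x ∈ {x : Fin d → ℝ≥0 | ε / 2 ≤ ordStat x i}
      · rw [Set.indicator_of_mem hx]
        exact hGM n x
      · rw [Set.indicator_of_notMem hx, norm_le_zero_iff]
        by_contra hne
        exact hx (hGsupp n x hne)
    · refine tendsto_order.2 ⟨fun a ha => Eventually.of_forall fun n => ha.trans_le (hG0 n x),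
        fun a ha => ?_⟩
      have hcont : Tendsto (D x) (𝓝 1) (𝓝 0) := by
        have := (hDx x).tendsto 1
        simpa [D] using this
      obtain ⟨δ, hδ, hball⟩ := Metric.eventually_nhds_iff.1
        (hcont.eventually_lt_const (half_pos ha))
      filter_upwards [tendsto_one_div_add_atTop_nhds_zero_nat.eventually_lt_const hδ] with n hn
      exact (hGle n x _ fun b hb => (hball (lt_of_le_of_lt hb hn)).le).trans_lt (half_lt_self ha)
  rw [Metric.tendsto_nhds]
  intro e he
  obtain ⟨n, hn⟩ := (hGlim.eventually_lt_const (half_pos he)).exists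
  have h1 : ∀ᶠ t in l, ∫ x, G n x ∂(ν t) < e / 2 :=
    (h (GB n) (hGB n)).eventually_lt_const hn
  have h2 := (Metric.tendsto_nhds.1 (h f hf)) (e / 2) (half_pos he)
  have h3 : ∀ᶠ t in l, c t ∈ K n := hc (Metric.closedBall_mem_nhds _ (by positivity))
  filter_upwards [h1, h2, h3] with t ht1 ht2 ht3
  have hint1 : Integrable f (ν t) := f.integrable _
  have hint2 : Integrable (fun x => f (c t • x)) (ν t) :=
    (f.compContinuous ⟨fun x => c t • x, continuous_nnreal_smul.comp (by fun_prop :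
      Continuous fun x : Fin d → ℝ≥0 => (x, c t))⟩).integrable _
  have hint3 : Integrable (G n) (ν t) := (GB n).integrable _
  have hle : dist (∫ x, f (c t • x) ∂(ν t)) (∫ x, f x ∂(ν t)) ≤ ∫ x, G n x ∂(ν t) := by
    rw [dist_eq_norm, ← integral_sub hint2 hint1]
    refine (norm_integral_le_integral_norm _).trans (integral_mono (hint2.sub hint1).norm hint3 ?_)
    exact fun x => hDG n x (c t) ht3
  calc dist (∫ x, f (c t • x) ∂(ν t)) (∫ x, f x ∂μ)
      ≤ dist (∫ x, f (c t • x) ∂(ν t)) (∫ x, f x ∂(ν t)) + dist (∫ x, f x ∂(ν t)) (∫ x, f x ∂μ) :=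
        dist_triangle _ _ _
    _ < e := by linarith

end

/-! ### Tails of the order statistics of a regularly varying vector -/

/-- `P (Z^{(i)} > s)` as a nonnegative real; `P` is meant to be finite. -/
noncomputable def tailProb {Ω : Type*} [MeasurableSpace Ω] (P : Measure Ω) {d : ℕ}
    (Z : Ω → Fin d → ℝ≥0) (i : ℕ) (s : ℝ≥0) : ℝ≥0 :=
  (P {ω | s < ordStat (Z ω) i}).toNNReal

/-- The law of `Z / s` divided by `P (Z^{(i)} > s)`. -/
noncomputable def scaledLaw {Ω : Type*} [MeasurableSpace Ω] (P : Measure Ω) {d : ℕ}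
    (Z : Ω → Fin d → ℝ≥0) (i : ℕ) (s : ℝ≥0) : Measure (Fin d → ℝ≥0) :=
  (tailProb P Z i s)⁻¹ • P.map fun ω => s⁻¹ • Z ω

section

variable {Ω : Type*} [MeasurableSpace Ω] {P : Measure Ω} {d i : ℕ} {Z : Ω → Fin d → ℝ≥0}

theorem coe_tailProb (s : ℝ≥0) : (tailProb P Z i s : ℝ) = P.real {ω | s < ordStat (Z ω) i} := rfl

theorem measurable_nnreal_smul {Y : Ω → Fin d → ℝ≥0} (hY : Measurable Y) (c : ℝ≥0) :
    Measurable fun ω => c • Y ω :=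
  (continuous_nnreal_smul.comp
    (by fun_prop : Continuous fun x : Fin d → ℝ≥0 => (x, c))).measurable.comp hY

theorem measurableSet_lt_ordStat (hi : 1 ≤ i) (hid : i ≤ d) (hZ : Measurable Z) (s : ℝ≥0) :
    MeasurableSet {ω | s < ordStat (Z ω) i} :=
  measurableSet_lt measurable_const ((measurable_ordStat hi hid).comp hZ)

theorem integral_smul_map {Y : Ω → Fin d → ℝ≥0} (hY : Measurable Y) (r c : ℝ≥0)
    {f : (Fin d → ℝ≥0) → ℝ} (hf : Measurable f) :
    ∫ x, f x ∂(r • P.map fun ω => c • Y ω) = r * ∫ ω, f (c • Y ω) ∂P := by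
  rw [integral_smul_nnreal_measure, integral_map (measurable_nnreal_smul hY c).aemeasurable
    hf.aestronglyMeasurable]
  rfl

theorem measureReal_smul_map {Y : Ω → Fin d → ℝ≥0} (hY : Measurable Y) (r c : ℝ≥0)
    {B : Set (Fin d → ℝ≥0)} (hB : MeasurableSet B) :
    (r • P.map fun ω => c • Y ω).real B = r * P.real {ω | c • Y ω ∈ B} := by
  rw [measureReal_nnreal_smul_apply, map_measureReal_apply (measurable_nnreal_smul hY c) hB]
  rfl

variable {μ : Measure (Fin d → ℝ≥0)} {α : ℝ} {b : ℝ≥0 → ℝ≥0}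

/-- The Potter bound for the tail of `Z^{(i)}`, in terms of the scaled laws. -/
theorem MRV.exists_scaledLaw_le (hi : 1 ≤ i) (hid : i ≤ d) (hZ : Measurable Z)
    (hb : IsTailQuantile (tailProb P Z i) b) (h : MRV P Z α b μ (CA d (i - 1))) {p : ℝ}
    (hp : α < p) : ∃ K : ℝ≥0, ∀ᶠ s in atTop, ∀ u : ℝ≥0, 1 ≤ u →
      (scaledLaw P Z i s).real {x | u⁻¹ < ordStat x i} ≤ ((K * u ^ p : ℝ≥0) : ℝ) := by
  obtain ⟨hα, hRV, -, -, -⟩ := h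
  obtain ⟨K, s₀, hK⟩ := hb.exists_potter hα hRV hp
  refine ⟨K, ?_⟩
  filter_upwards [eventually_ge_atTop s₀, eventually_gt_atTop 0] with s hs hs0 u hu
  have hT := hb.tail_pos hα hRV s
  rw [scaledLaw, measureReal_smul_map hZ _ _
    (measurableSet_lt measurable_const (measurable_ordStat hi hid))]
  have h1 : P.real {ω | s⁻¹ • Z ω ∈ {x : Fin d → ℝ≥0 | u⁻¹ < ordStat x i}} =
      tailProb P Z i (s / u) := by
    rw [coe_tailProb]
    congr 1
    ext ω
    rw [Set.mem_ofPred_eq, Set.mem_ofPred_eq, Set.mem_ofPred_eq, ordStat_smul _ _ hi hid,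
      inv_mul_eq_div, lt_div_iff₀ hs0, inv_mul_eq_div]
  rw [h1, ← NNReal.coe_mul, NNReal.coe_le_coe, inv_mul_eq_div, div_le_iff₀ hT]
  exact hK s hs u hu

variable [IsProbabilityMeasure P]

instance (s : ℝ≥0) : IsFiniteMeasure (scaledLaw P Z i s) := by
  unfold scaledLaw
  infer_instance

theorem ennreal_coe_tailProb (s : ℝ≥0) :
    (tailProb P Z i s : ℝ≥0∞) = P {ω | s < ordStat (Z ω) i} :=
  ENNReal.coe_toNNReal (measure_ne_top _ _)

theorem isTailQuantile_canonicalScale (hi : 1 ≤ i) (hid : i ≤ d) (hZ : Measurable Z) :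
    IsTailQuantile (tailProb P Z i) (canonicalScale P Z i) := by
  have hzero : Tendsto (tailProb P Z i) atTop (𝓝 0) := by
    have h1 : Tendsto (fun s : ℝ≥0 => P {ω | s < ordStat (Z ω) i}) atTop
        (𝓝 (P (⋂ s : ℝ≥0, {ω | s < ordStat (Z ω) i}))) :=
      tendsto_measure_iInter_atTop
        (fun s => (measurableSet_lt_ordStat hi hid hZ s).nullMeasurableSet)
        (fun s s' hs ω hω => lt_of_le_of_lt hs hω) ⟨0, measure_ne_top _ _⟩
    have h2 : (⋂ s : ℝ≥0, {ω | s < ordStat (Z ω) i}) = ∅ :=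
      Set.eq_empty_of_forall_notMem fun ω hω =>
        lt_irrefl (ordStat (Z ω) i) (Set.mem_iInter.1 hω (ordStat (Z ω) i))
    rw [h2, measure_empty] at h1
    exact (ENNReal.tendsto_toNNReal ENNReal.zero_ne_top).comp h1
  have hmem : ∀ {t : ℝ≥0} (x : ℝ≥0), 1 - 1 / (t : ℝ) ≤ P.real {ω | ordStat (Z ω) i ≤ x} ↔
      tailProb P Z i x ≤ t⁻¹ := fun {t} x => by
    have h1 : {ω | ordStat (Z ω) i ≤ x} = {ω | x < ordStat (Z ω) i}ᶜ := by
      ext ω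
      simp
    rw [h1, probReal_compl_eq_one_sub (measurableSet_lt_ordStat hi hid hZ x), ← NNReal.coe_le_coe,
      coe_tailProb, NNReal.coe_inv, one_div]
    constructor <;> intro h <;> linarith
  refine ⟨fun s s' hs => ?_, hzero, fun {t x} _ h => csInf_le (OrderBot.bddBelow _) ((hmem x).2 h),
    fun {t x} ht h => ?_⟩
  · exact ENNReal.toNNReal_mono (measure_ne_top _ _)
      (measure_mono fun ω hω => lt_of_le_of_lt hs hω)
  · have hne : {x : ℝ≥0 | 1 - 1 / (t : ℝ) ≤ P.real {ω | ordStat (Z ω) i ≤ x}}.Nonempty := by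
      obtain ⟨y, hy⟩ := (hzero.eventually_lt_const (inv_pos.2 ht)).exists
      exact ⟨y, (hmem y).2 hy.le⟩
    obtain ⟨y, hy, hyx⟩ := exists_lt_of_csInf_lt hne h
    refine le_trans ?_ ((hmem y).1 hy)
    exact ENNReal.toNNReal_mono (measure_ne_top _ _)
      (measure_mono fun ω hω => hyx.trans hω)

/-- The index `0` cannot occur: the limit measure would have mass at least `1 / 2` on
`{x | r ≤ x^{(i)}}` for every `r`. -/
theorem MRV.index_pos (hi : 1 ≤ i) (hid : i ≤ d) (hZ : Measurable Z)
    (hb : IsTailQuantile (tailProb P Z i) b) (h : MRV P Z α b μ (CA d (i - 1))) : 0 < α := by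
  obtain ⟨hα, hRV, -, hInM, hlim⟩ := h
  refine lt_of_le_of_ne hα fun h0 => ?_
  subst h0
  have hhalf : ∀ r : ℝ≥0, 0 < r → 1 / 2 ≤ μ.real {x | r ≤ ordStat x i} := by
    intro r hr
    have hr2 : 0 < 2 * r := by positivity
    have hM := hlim _ (boundedAway_support_cutoff hi hid hr2)
    have hle : ∫ x, cutoffBCF hi hid (2 * r) x ∂μ ≤ μ.real {x | r ≤ ordStat x i} := by
      have hfin := hInM.measure_le_ordStat_lt_top hi hid hr
      have e : 2 * r / 2 = r := mul_div_cancel_left₀ _ two_ne_zero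
      have hsub : {x : Fin d → ℝ≥0 | r < ordStat x i} ⊆ {x | r ≤ ordStat x i} :=
        fun x (hx : r < ordStat x i) => hx.le
      refine (integral_cutoff_le_measureReal hi hid hr2 ?_).trans ?_
      · rw [e]
        exact ((measure_mono hsub).trans_lt hfin).ne
      · rw [e]
        exact measureReal_mono hsub hfin.ne
    refine (ge_of_tendsto hM ?_).trans hle
    -- for the index `0` the quantile `b (2 t)` exceeds every multiple of `b t` eventually
    have hbig : ((2 * r : ℝ≥0) : ℝ≥0∞) < rpowInv 2 0 := by
      simp [rpowInv, ENNReal.mul_lt_top]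
    filter_upwards [hRV.eventually_mul_lt two_pos hbig, hRV.2.1, eventually_gt_atTop 0]
      with t ht hbt ht0
    have h1 : (t * 2)⁻¹ < tailProb P Z i (2 * r * b t) := by
      by_contra hle
      exact absurd (hb.le_of_tail_le (by positivity) (not_lt.1 hle)) (not_le.2 ht)
    refine le_trans ?_ (measureReal_le_integral_cutoff hi hid hr2
      (BoundedContinuousFunction.integrable _ _))
    rw [measureReal_smul_map hZ _ _ (measurableSet_le measurable_const (measurable_ordStat hi hid))]
    have h2 : (tailProb P Z i (2 * r * b t) : ℝ) ≤
        P.real {ω | (b t)⁻¹ • Z ω ∈ {x : Fin d → ℝ≥0 | 2 * r ≤ ordStat x i}} := by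
      rw [coe_tailProb]
      refine measureReal_mono fun ω hω => ?_
      rw [Set.mem_ofPred_eq, Set.mem_ofPred_eq, ordStat_smul _ _ hi hid, inv_mul_eq_div,
        le_div_iff₀ hbt]
      exact le_of_lt hω
    have h3 : (t : ℝ) * ((t * 2)⁻¹ : ℝ≥0) = 1 / 2 := by
      rw [NNReal.coe_inv, NNReal.coe_mul, NNReal.coe_ofNat]
      have : (t : ℝ) ≠ 0 := by positivity
      field_simp
    rw [← h3]
    have h4 : (((t * 2)⁻¹ : ℝ≥0) : ℝ) ≤ tailProb P Z i (2 * r * b t) := by exact_mod_cast h1.le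
    exact mul_le_mul_of_nonneg_left (h4.trans h2) t.coe_nonneg
  have hInt : Tendsto (fun n : ℕ => μ {x : Fin d → ℝ≥0 | (n : ℝ≥0) + 1 ≤ ordStat x i}) atTop
      (𝓝 (μ (⋂ n : ℕ, {x : Fin d → ℝ≥0 | (n : ℝ≥0) + 1 ≤ ordStat x i}))) :=
    tendsto_measure_iInter_atTop
      (fun n => (measurableSet_le measurable_const
        (measurable_ordStat hi hid)).nullMeasurableSet)
      (fun n m hnm x (hx : (m : ℝ≥0) + 1 ≤ ordStat x i) => le_trans (by gcongr) hx)
      ⟨0, (hInM.measure_le_ordStat_lt_top hi hid (by positivity)).ne⟩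
  have hempty : (⋂ n : ℕ, {x : Fin d → ℝ≥0 | (n : ℝ≥0) + 1 ≤ ordStat x i}) = ∅ := by
    refine Set.eq_empty_of_forall_notMem fun x hx => ?_
    obtain ⟨n, hn⟩ := exists_nat_ge (ordStat x i)
    exact absurd (Set.mem_iInter.1 hx n) (not_le.2 (hn.trans_lt (lt_add_one _)))
  rw [hempty, measure_empty] at hInt
  have hInt' := (ENNReal.tendsto_toReal ENNReal.zero_ne_top).comp hInt
  have := ge_of_tendsto hInt'
    (Eventually.of_forall fun n : ℕ => hhalf ((n : ℝ≥0) + 1) (by positivity))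
  norm_num at this

/-- Multivariate regular variation with the scaling function replaced by the tail of `Z^{(i)}`. -/
theorem MRV.tendstoAway_scaledLaw (hi : 1 ≤ i) (hid : i ≤ d) (hZ : Measurable Z)
    (hb : IsTailQuantile (tailProb P Z i) b) (h : MRV P Z α b μ (CA d (i - 1))) :
    TendstoAway (CA d (i - 1)) (scaledLaw P Z i) atTop μ := by
  have hα := h.index_pos hi hid hZ hb
  obtain ⟨-, hRV, -, hInM, hlim⟩ := h
  intro f hf
  have hT := hb.tendsto_inv_tail hα.le hRV
  have hlim' : TendstoAway (CA d (i - 1)) (fun s : ℝ≥0 => (tailProb P Z i s)⁻¹ •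
      P.map fun ω => (b (tailProb P Z i s)⁻¹)⁻¹ • Z ω) atTop μ :=
    fun g hg => (hlim g hg).comp hT
  refine (hlim'.rescale hi hid hInM (hb.tendsto_quantile_inv_tail_div hα hRV) f hf).congr' ?_
  filter_upwards [hT.eventually hRV.2.1] with s hs
  have hm := f.continuous.measurable
  have hm' : Measurable fun x : Fin d → ℝ≥0 => f ((b (tailProb P Z i s)⁻¹ / s) • x) :=
    hm.comp (measurable_nnreal_smul measurable_id _)
  rw [scaledLaw, integral_smul_map hZ _ _ hm, integral_smul_map hZ _ _ hm']
  congr 2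
  ext ω
  rw [smul_smul, div_mul_eq_mul_div, mul_inv_cancel₀ hs.ne', one_div]

/-- The Potter bound passes to the limit measure. -/
theorem MRV.exists_measure_le (hi : 1 ≤ i) (hid : i ≤ d) (hZ : Measurable Z)
    (hb : IsTailQuantile (tailProb P Z i) b) (h : MRV P Z α b μ (CA d (i - 1))) {p : ℝ}
    (hp : α < p) : ∃ K : ℝ≥0, ∀ u : ℝ≥0, 1 ≤ u →
      μ {x | u⁻¹ ≤ ordStat x i} ≤ ((K * u ^ p : ℝ≥0) : ℝ≥0∞) := by
  have hlim := h.tendstoAway_scaledLaw hi hid hZ hb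
  obtain ⟨K, hK⟩ := h.exists_scaledLaw_le hi hid hZ hb hp
  have hInM := h.2.2.2.1
  refine ⟨K * 2 ^ p, fun u hu => ?_⟩
  have hui : 0 < u⁻¹ := inv_pos.2 (zero_lt_one.trans_le hu)
  have hcut : Integrable (cutoffBCF hi hid u⁻¹) μ := by
    refine hInM.integrable hi hid (cutoffBCF hi hid u⁻¹).continuous.measurable
      (fun x => (cutoffBCF hi hid u⁻¹).norm_coe_le_norm x) (ε := u⁻¹ / 2) (by positivity)
      fun x hx => (lt_ordStat_of_cutoff_ne_zero hui fun h0 => hx ?_).le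
    change (cutoff i u⁻¹ x : ℝ) = 0
    rw [h0, NNReal.coe_zero]
  have hle : μ.real {x | u⁻¹ ≤ ordStat x i} ≤ ((K * (2 * u) ^ p : ℝ≥0) : ℝ) := by
    refine (measureReal_le_integral_cutoff hi hid hui hcut).trans
      (le_of_tendsto (hlim _ (boundedAway_support_cutoff hi hid hui)) ?_)
    filter_upwards [hK] with s hs
    refine (integral_cutoff_le_measureReal hi hid hui (measure_ne_top _ _)).trans ?_
    have h2 : u⁻¹ / 2 = (2 * u)⁻¹ := by rw [mul_inv, div_eq_inv_mul]
    rw [h2]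
    exact hs (2 * u) (hu.trans (le_mul_of_one_le_left' one_le_two))
  rw [mul_assoc, ← NNReal.mul_rpow, ← ENNReal.ofReal_coe_nnreal]
  exact (ENNReal.le_ofReal_iff_toReal_le (hInM.measure_le_ordStat_lt_top hi hid hui).ne
    (NNReal.coe_nonneg _)).2 hle

end

/-! ### The random matrix -/

section

variable {Ω : Type*} {q d k i : ℕ} {A : Ω → Matrix (Fin q) (Fin d) ℝ≥0}

theorem pairwise_disjoint_OmegaPart : Pairwise (Function.onFun Disjoint (OmegaPart A k)) :=
  fun _ _ hij => Set.disjoint_left.2 fun _ h h' => hij (h.unique h')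

theorem iUnion_OmegaPart (hk : 1 ≤ k) (hkq : k ≤ q) (hd : 1 ≤ d) :
    ⋃ i ∈ Finset.Icc 1 d, OmegaPart A k i = Set.univ := by
  refine Set.eq_univ_of_forall fun ω => ?_
  have hbdd : ∀ j ∈ {j : ℕ | 1 ≤ j ∧ j ≤ d ∧ tau k j (A ω) < ∞}, j ≤ d := fun j hj => hj.2.1
  have hmem := Nat.sSup_mem (s := {j : ℕ | 1 ≤ j ∧ j ≤ d ∧ tau k j (A ω) < ∞})
    ⟨1, le_rfl, hd, tau_one_lt_top hk hkq hd (A ω)⟩ ⟨d, hbdd⟩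
  exact Set.mem_iUnion₂.2 ⟨_, Finset.mem_Icc.2 ⟨hmem.1, hmem.2.1⟩, hmem,
    fun j hj => le_csSup ⟨d, hbdd⟩ hj⟩

variable [MeasurableSpace Ω] {P : Measure Ω}

theorem measurableSet_isGreatest_tau (hk : 1 ≤ k) (hkq : k ≤ q) (i : ℕ) :
    MeasurableSet {M : Matrix (Fin q) (Fin d) ℝ≥0 |
      IsGreatest {j : ℕ | 1 ≤ j ∧ j ≤ d ∧ tau k j M < ∞} i} := by
  have hlt : ∀ j, MeasurableSet {M : Matrix (Fin q) (Fin d) ℝ≥0 | tau k j M < ∞} := fun j =>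
    measurableSet_lt (measurable_tau hk hkq) measurable_const
  have heq : {M : Matrix (Fin q) (Fin d) ℝ≥0 |
      IsGreatest {j : ℕ | 1 ≤ j ∧ j ≤ d ∧ tau k j M < ∞} i} =
      ({_M | 1 ≤ i ∧ i ≤ d} ∩ {M | tau k i M < ∞}) ∩
        ⋂ j : ℕ, ({M | tau k j M < ∞}ᶜ ∪ {_M | 1 ≤ j → j ≤ d → j ≤ i}) := by
    ext M
    constructor
    · rintro ⟨⟨h1, h2, h3⟩, h4⟩
      refine ⟨⟨⟨h1, h2⟩, h3⟩, Set.mem_iInter.2 fun j => ?_⟩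
      by_cases hj : tau k j M < ∞
      · exact Or.inr fun h5 h6 => h4 ⟨h5, h6, hj⟩
      · exact Or.inl hj
    · rintro ⟨⟨⟨h1, h2⟩, h3⟩, h4⟩
      refine ⟨⟨h1, h2, h3⟩, fun j hj => ?_⟩
      rcases Set.mem_iInter.1 h4 j with h5 | h5
      · exact absurd hj.2.2 h5
      · exact h5 hj.1 hj.2.1
  rw [heq]
  exact ((MeasurableSet.const _).inter (hlt i)).inter
    (MeasurableSet.iInter fun j => (hlt j).compl.union (MeasurableSet.const _))

theorem measurableSet_OmegaPart (hk : 1 ≤ k) (hkq : k ≤ q) (hA : Measurable A) (i : ℕ) :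
    MeasurableSet (OmegaPart A k i) :=
  hA (measurableSet_isGreatest_tau hk hkq i)

theorem measurable_mulVec :
    Measurable fun p : Matrix (Fin q) (Fin d) ℝ≥0 × (Fin d → ℝ≥0) => p.1 *ᵥ p.2 := by
  refine measurable_pi_lambda _ fun l => ?_
  simp_rw [mulVec_apply_eq_sum]
  refine Finset.measurable_sum _ fun j _ => Measurable.mul ?_ ?_
  · exact (measurable_pi_apply j).comp ((measurable_pi_apply l).comp measurable_fst)
  · exact (measurable_pi_apply j).comp measurable_snd

theorem measurable_mulVec_right (M : Matrix (Fin q) (Fin d) ℝ≥0) :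
    Measurable fun z : Fin d → ℝ≥0 => M *ᵥ z :=
  (continuous_matrix_mulVec M).measurable

/-- Where `M *ᵥ x` is away from `CA q (k - 1)`, the vector `x` is away from `CA d (i - 1)`, at a
distance controlled by `tau k i M`. The two summands `1` keep the factor positive, and at least
`1` as the Potter bound requires. -/
theorem inv_lt_ordStat (hk : 1 ≤ k) (hkq : k ≤ q) (hi : 1 ≤ i) (hid : i ≤ d)
    (M : Matrix (Fin q) (Fin d) ℝ≥0) (hM : tau k i M < ∞) {ε : ℝ≥0} (hε : 0 < ε)
    {x : Fin d → ℝ≥0} (hx : ε ≤ ordStat (M *ᵥ x) k) :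
    (((tau k i M).toNNReal + 1) * (ε⁻¹ + 1))⁻¹ < ordStat x i := by
  have h1 := hx.trans (ordStat_mulVec_le_tau hk hkq hi hid M x hM)
  have h0 : 0 < ordStat x i := by
    by_contra hle
    rw [nonpos_iff_eq_zero.1 (not_lt.1 hle), mul_zero] at h1
    exact absurd h1 (not_le.2 hε)
  rw [inv_lt_iff_one_lt_mul₀ (by positivity), mul_comm]
  calc (1 : ℝ≥0) = ε * ε⁻¹ := (mul_inv_cancel₀ hε.ne').symm
    _ ≤ (tau k i M).toNNReal * ordStat x i * ε⁻¹ := by gcongr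
    _ < ((tau k i M).toNNReal + 1) * (ε⁻¹ + 1) * ordStat x i := by
      have : ((tau k i M).toNNReal + 1) * (ε⁻¹ + 1) * ordStat x i =
        (tau k i M).toNNReal * ordStat x i * ε⁻¹ +
          ((tau k i M).toNNReal + ε⁻¹ + 1) * ordStat x i := by ring
      rw [this]
      exact lt_add_of_pos_right _ (by positivity)

theorem one_le_dominating (M : Matrix (Fin q) (Fin d) ℝ≥0) (ε : ℝ≥0) :
    1 ≤ ((tau k i M).toNNReal + 1) * (ε⁻¹ + 1) :=
  one_le_mul (le_add_of_nonneg_left zero_le) (le_add_of_nonneg_left zero_le)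

theorem measurable_dominating (hk : 1 ≤ k) (hkq : k ≤ q) (hA : Measurable A) (ε : ℝ≥0) (p : ℝ) :
    Measurable fun ω => (((tau k i (A ω)).toNNReal + 1) * (ε⁻¹ + 1)) ^ p :=
  (((((measurable_tau hk hkq).comp hA).ennreal_toNNReal.add_const _).mul_const _).pow_const _)

theorem lintegral_dominating_lt_top [IsFiniteMeasure P] (hk : 1 ≤ k) (hkq : k ≤ q)
    (hA : Measurable A) {p : ℝ} (hp : 0 ≤ p)
    (hmom : ∫⁻ ω in OmegaPart A k i, tau k i (A ω) ^ p ∂P < ∞) (ε : ℝ≥0) :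
    ∫⁻ ω in OmegaPart A k i,
      (((((tau k i (A ω)).toNNReal + 1) * (ε⁻¹ + 1)) ^ p : ℝ≥0) : ℝ≥0∞) ∂P < ∞ := by
  let c : ℝ≥0 := 2 ^ p * (ε⁻¹ + 1) ^ p
  have hle : ∀ τ : ℝ≥0, ((τ + 1) * (ε⁻¹ + 1)) ^ p ≤ c * (τ ^ p + 1) := fun τ => by
    have h1 : (τ + 1) ^ p ≤ 2 ^ p * (τ ^ p + 1) := by
      rcases le_total τ 1 with h | h
      · calc (τ + 1) ^ p ≤ 2 ^ p := by
              refine NNReal.rpow_le_rpow ?_ hp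
              rw [← one_add_one_eq_two]
              gcongr
          _ ≤ 2 ^ p * (τ ^ p + 1) := le_mul_of_one_le_right' (le_add_of_nonneg_left zero_le)
      · calc (τ + 1) ^ p ≤ (2 * τ) ^ p := by
              refine NNReal.rpow_le_rpow ?_ hp
              rw [two_mul]
              gcongr
          _ = 2 ^ p * τ ^ p := NNReal.mul_rpow ..
          _ ≤ 2 ^ p * (τ ^ p + 1) := by
              gcongr
              exact le_add_of_nonneg_right zero_le
    calc ((τ + 1) * (ε⁻¹ + 1)) ^ p = (τ + 1) ^ p * (ε⁻¹ + 1) ^ p := NNReal.mul_rpow ..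
      _ ≤ 2 ^ p * (τ ^ p + 1) * (ε⁻¹ + 1) ^ p := by gcongr
      _ = c * (τ ^ p + 1) := by ring
  calc ∫⁻ ω in OmegaPart A k i,
      (((((tau k i (A ω)).toNNReal + 1) * (ε⁻¹ + 1)) ^ p : ℝ≥0) : ℝ≥0∞) ∂P
      ≤ ∫⁻ ω in OmegaPart A k i, (c : ℝ≥0∞) * (tau k i (A ω) ^ p + 1) ∂P := by
        refine setLIntegral_mono' (measurableSet_OmegaPart hk hkq hA i) fun ω hω => ?_
        have hτ : tau k i (A ω) ^ p = (((tau k i (A ω)).toNNReal ^ p : ℝ≥0) : ℝ≥0∞) := by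
          rw [ENNReal.coe_rpow_of_nonneg _ hp, ENNReal.coe_toNNReal hω.1.2.2.ne]
        rw [hτ]
        exact_mod_cast hle _
    _ = c * (∫⁻ ω in OmegaPart A k i, tau k i (A ω) ^ p ∂P + P (OmegaPart A k i)) := by
        rw [lintegral_const_mul' _ _ ENNReal.coe_ne_top, lintegral_add_right _ measurable_const]
        simp
    _ < ∞ := ENNReal.mul_lt_top ENNReal.coe_lt_top
        (ENNReal.add_lt_top.2 ⟨hmom, measure_lt_top _ _⟩)

variable {Z : Ω → Fin d → ℝ≥0}

/-- Fubini's theorem for two independent random variables. -/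
theorem setIntegral_of_indepFun [IsProbabilityMeasure P] (hA : Measurable A) (hZ : Measurable Z)
    (hAZ : IndepFun A Z P) {S : Set (Matrix (Fin q) (Fin d) ℝ≥0)} (hS : MeasurableSet S)
    {φ : Matrix (Fin q) (Fin d) ℝ≥0 × (Fin d → ℝ≥0) → ℝ} (hφ : Measurable φ) {M : ℝ}
    (hM : ∀ x, |φ x| ≤ M) :
    ∫ ω in A ⁻¹' S, φ (A ω, Z ω) ∂P = ∫ ω in A ⁻¹' S, ∫ ω', φ (A ω, Z ω') ∂P ∂P := by
  have hM0 : 0 ≤ M := (abs_nonneg _).trans (hM 0)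
  have hF : Measurable ((Prod.fst ⁻¹' S).indicator φ) := hφ.indicator (measurable_fst hS)
  have hmap := (indepFun_iff_map_prod_eq_prod_map_map hA.aemeasurable hZ.aemeasurable).1 hAZ
  have := Measure.isProbabilityMeasure_map (μ := P) hA.aemeasurable
  have := Measure.isProbabilityMeasure_map (μ := P) hZ.aemeasurable
  have hint : Integrable ((Prod.fst ⁻¹' S).indicator φ) ((P.map A).prod (P.map Z)) := by
    refine Integrable.of_bound hF.aestronglyMeasurable M (Eventually.of_forall fun x => ?_)
    by_cases hx : x ∈ Prod.fst ⁻¹' S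
    · rw [Set.indicator_of_mem hx]
      exact hM x
    · rw [Set.indicator_of_notMem hx, norm_zero]
      exact hM0
  calc ∫ ω in A ⁻¹' S, φ (A ω, Z ω) ∂P
      = ∫ ω, (Prod.fst ⁻¹' S).indicator φ (A ω, Z ω) ∂P := (integral_indicator (hA hS)).symm
    _ = ∫ x, (Prod.fst ⁻¹' S).indicator φ x ∂(P.map fun ω => (A ω, Z ω)) :=
        (integral_map (hA.prodMk hZ).aemeasurable hF.aestronglyMeasurable).symm
    _ = ∫ a, ∫ z, (Prod.fst ⁻¹' S).indicator φ (a, z) ∂(P.map Z) ∂(P.map A) := by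
        rw [hmap, integral_prod _ hint]
    _ = ∫ ω, ∫ z, (Prod.fst ⁻¹' S).indicator φ (A ω, z) ∂(P.map Z) ∂P :=
        integral_map hA.aemeasurable hint.aestronglyMeasurable.integral_prod_right'
    _ = ∫ ω, (A ⁻¹' S).indicator (fun ω => ∫ ω', φ (A ω, Z ω') ∂P) ω ∂P := by
        refine integral_congr_ae (Eventually.of_forall fun ω => ?_)
        refine (integral_map hZ.aemeasurable
          (hF.comp measurable_prodMk_left).aestronglyMeasurable).trans ?_
        by_cases hω : A ω ∈ S
        · rw [Set.indicator_of_mem (show ω ∈ A ⁻¹' S from hω)]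
          congr 1
          ext ω'
          exact Set.indicator_of_mem (show (A ω, Z ω') ∈ Prod.fst ⁻¹' S from hω) _
        · rw [Set.indicator_of_notMem (show ω ∉ A ⁻¹' S from hω)]
          refine integral_eq_zero_of_ae (Eventually.of_forall fun ω' => ?_)
          exact Set.indicator_of_notMem (show (A ω, Z ω') ∉ Prod.fst ⁻¹' S from hω) _
    _ = ∫ ω in A ⁻¹' S, ∫ ω', φ (A ω, Z ω') ∂P ∂P := integral_indicator (hA hS)

theorem inv_tailProb_mul_setIntegral [IsProbabilityMeasure P] (hk : 1 ≤ k) (hkq : k ≤ q)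
    (hA : Measurable A) (hZ : Measurable Z) (hAZ : IndepFun A Z P) {g : (Fin q → ℝ≥0) → ℝ}
    (hg : Measurable g) {M : ℝ} (hM : ∀ x, |g x| ≤ M) (t : ℝ≥0) :
    (tailProb P Z i t : ℝ)⁻¹ * ∫ ω in OmegaPart A k i, g (t⁻¹ • (A ω *ᵥ Z ω)) ∂P =
      ∫ ω in OmegaPart A k i, ∫ x, g (A ω *ᵥ x) ∂(scaledLaw P Z i t) ∂P := by
  have hφ : Measurable fun p : Matrix (Fin q) (Fin d) ℝ≥0 × (Fin d → ℝ≥0) =>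
      g (t⁻¹ • (p.1 *ᵥ p.2)) := hg.comp (measurable_nnreal_smul measurable_mulVec _)
  have h1 := setIntegral_of_indepFun hA hZ hAZ (measurableSet_isGreatest_tau hk hkq i) hφ
    (M := M) fun x => hM _
  have hset : OmegaPart A k i = A ⁻¹' {M | IsGreatest {j : ℕ | 1 ≤ j ∧ j ≤ d ∧ tau k j M < ∞} i} :=
    rfl
  rw [hset, h1, ← integral_const_mul]
  refine integral_congr_ae (Eventually.of_forall fun ω => ?_)
  have h2 := integral_smul_map (P := P) hZ (tailProb P Z i t)⁻¹ t⁻¹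
    (hg.comp (measurable_mulVec_right (A ω)))
  simp only [Function.comp_apply, Matrix.mulVec_smul, NNReal.coe_inv] at h2
  exact h2.symm

variable {μ : Measure (Fin d → ℝ≥0)}

theorem measurable_measure_preim (hA : Measurable A) [SFinite μ] {C : Set (Fin q → ℝ≥0)}
    (hC : MeasurableSet C) : Measurable fun ω => μ (preim (A ω) C) :=
  (measurable_measure_prodMk_left (measurable_mulVec hC)).comp hA

theorem measure_preim_lt_top (hk : 1 ≤ k) (hkq : k ≤ q) (hi : 1 ≤ i) (hid : i ≤ d)
    (hμ : InM (CA d (i - 1)) μ) {B : Matrix (Fin q) (Fin d) ℝ≥0} (hB : tau k i B < ∞)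
    {C : Set (Fin q → ℝ≥0)} (hC : BoundedAway (CA q (k - 1)) C) : μ (preim B C) < ∞ := by
  obtain ⟨ε, hε, hCε⟩ := (boundedAway_iff hk hkq _).1 hC
  refine (measure_mono fun x hx => ?_).trans_lt (hμ.measure_le_ordStat_lt_top hi hid
    (ε := (((tau k i B).toNNReal + 1) * (ε⁻¹ + 1))⁻¹) (by positivity))
  exact (inv_lt_ordStat hk hkq hi hid B hB hε (hCε _ hx)).le

theorem toReal_meanMass (hk : 1 ≤ k) (hkq : k ≤ q) (hi : 1 ≤ i) (hid : i ≤ d) (hA : Measurable A)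
    (hμ : InM (CA d (i - 1)) μ) {C : Set (Fin q → ℝ≥0)} (hCm : MeasurableSet C)
    (hC : BoundedAway (CA q (k - 1)) C) :
    ∫ ω in OmegaPart A k i, ∫ x, C.indicator (fun _ => (1 : ℝ)) (A ω *ᵥ x) ∂μ ∂P =
      (meanMass P A μ k i C).toReal := by
  have := hμ.sigmaFinite hi hid
  rw [meanMass, ← integral_toReal (measurable_measure_preim hA hCm).aemeasurable
    ((ae_restrict_iff' (measurableSet_OmegaPart hk hkq hA i)).2 (Eventually.of_forall fun ω hω =>
      measure_preim_lt_top hk hkq hi hid hμ hω.1.2.2 hC))]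
  refine integral_congr_ae (Eventually.of_forall fun ω => ?_)
  exact integral_indicator_one (measurable_mulVec_right (A ω) hCm)

variable [IsProbabilityMeasure P] {α p : ℝ} {b : ℝ≥0 → ℝ≥0}

/-- Breiman's argument on `OmegaPart A k i`: conditionally on the matrix, the convergence is that
of the scaled laws of `Z`; the Potter bound and the moment condition dominate the integrands. -/
theorem tendsto_setIntegral_OmegaPart (hk : 1 ≤ k) (hkq : k ≤ q) (hi : 1 ≤ i) (hid : i ≤ d)
    (hA : Measurable A) (hZ : Measurable Z) (hAZ : IndepFun A Z P)
    (hb : IsTailQuantile (tailProb P Z i) b) (h : MRV P Z α b μ (CA d (i - 1)))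
    (hp : α < p) (hmom : ∫⁻ ω in OmegaPart A k i, tau k i (A ω) ^ p ∂P < ∞)
    {g : (Fin q → ℝ≥0) → ℝ} (hg : Measurable g) {M : ℝ} (hM : ∀ x, |g x| ≤ M)
    {ε : ℝ≥0} (hε : 0 < ε) (hsupp : ∀ x, g x ≠ 0 → ε ≤ ordStat x k)
    (hconv : ∀ᵐ ω ∂P, ω ∈ OmegaPart A k i →
      Tendsto (fun t => ∫ x, g (A ω *ᵥ x) ∂(scaledLaw P Z i t)) atTop
        (𝓝 (∫ x, g (A ω *ᵥ x) ∂μ))) :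
    Tendsto (fun t => (tailProb P Z i t : ℝ)⁻¹ *
        ∫ ω in OmegaPart A k i, g (t⁻¹ • (A ω *ᵥ Z ω)) ∂P) atTop
      (𝓝 (∫ ω in OmegaPart A k i, ∫ x, g (A ω *ᵥ x) ∂μ ∂P)) := by
  simp_rw [inv_tailProb_mul_setIntegral hk hkq hA hZ hAZ hg hM]
  have hM0 : 0 ≤ M := (abs_nonneg _).trans (hM 0)
  obtain ⟨K, hK⟩ := h.exists_scaledLaw_le hi hid hZ hb hp
  have hOm := measurableSet_OmegaPart hk hkq hA i
  let U : Ω → ℝ≥0 := fun ω => (((tau k i (A ω)).toNNReal + 1) * (ε⁻¹ + 1)) ^ p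
  have hU : Measurable U := measurable_dominating hk hkq hA ε p
  have hUint : Integrable (fun ω => (U ω : ℝ)) (P.restrict (OmegaPart A k i)) := by
    refine ⟨hU.coe_nnreal_real.aestronglyMeasurable, ?_⟩
    rw [hasFiniteIntegral_iff_ofReal (Eventually.of_forall fun ω => (U ω).coe_nonneg)]
    simp_rw [ENNReal.ofReal_coe_nnreal]
    exact lintegral_dominating_lt_top hk hkq hA (h.1.trans hp.le) hmom ε
  refine tendsto_integral_filter_of_dominated_convergence (fun ω => M * (K * U ω))
    (Eventually.of_forall fun t => ?_) ?_ ((hUint.const_mul _).const_mul _) ?_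
  · have h1 : StronglyMeasurable fun p : Matrix (Fin q) (Fin d) ℝ≥0 × (Fin d → ℝ≥0) =>
        g (p.1 *ᵥ p.2) := (hg.comp measurable_mulVec).stronglyMeasurable
    exact (h1.integral_prod_right'.comp_measurable hA).aestronglyMeasurable
  · filter_upwards [hK] with t ht
    rw [ae_restrict_iff' hOm]
    refine Eventually.of_forall fun ω hω => ?_
    have hτ : tau k i (A ω) < ∞ := hω.1.2.2
    set u := ((tau k i (A ω)).toNNReal + 1) * (ε⁻¹ + 1) with hu
    have hzero : ∀ x ∉ {x : Fin d → ℝ≥0 | u⁻¹ < ordStat x i}, g (A ω *ᵥ x) = 0 := fun x hx => by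
      by_contra hne
      exact hx (inv_lt_ordStat hk hkq hi hid _ hτ hε (hsupp _ hne))
    rw [← setIntegral_eq_integral_of_forall_compl_eq_zero hzero]
    refine (norm_setIntegral_le_of_norm_le_const (measure_lt_top _ _)
      fun x _ => hM (A ω *ᵥ x)).trans ?_
    refine mul_le_mul_of_nonneg_left ?_ hM0
    rw [← NNReal.coe_mul]
    exact ht u (one_le_dominating _ _)
  · exact (ae_restrict_iff' hOm).2 hconv

theorem meanMass_lt_top (hk : 1 ≤ k) (hkq : k ≤ q) (hi : 1 ≤ i) (hid : i ≤ d)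
    (hA : Measurable A) (hZ : Measurable Z)
    (hb : IsTailQuantile (tailProb P Z i) b) (h : MRV P Z α b μ (CA d (i - 1)))
    (hp : α < p) (hmom : ∫⁻ ω in OmegaPart A k i, tau k i (A ω) ^ p ∂P < ∞)
    {C : Set (Fin q → ℝ≥0)} (hC : BoundedAway (CA q (k - 1)) C) :
    meanMass P A μ k i C < ∞ := by
  obtain ⟨ε, hε, hCε⟩ := (boundedAway_iff hk hkq _).1 hC
  obtain ⟨K, hK⟩ := h.exists_measure_le hi hid hZ hb hp
  calc meanMass P A μ k i C
      ≤ ∫⁻ ω in OmegaPart A k i, (K : ℝ≥0∞) *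
        (((((tau k i (A ω)).toNNReal + 1) * (ε⁻¹ + 1)) ^ p : ℝ≥0) : ℝ≥0∞) ∂P := by
        refine setLIntegral_mono' (measurableSet_OmegaPart hk hkq hA i) fun ω hω => ?_
        rw [← ENNReal.coe_mul]
        refine (measure_mono fun x hx => ?_).trans (hK _ (one_le_dominating (A ω) ε))
        exact (inv_lt_ordStat hk hkq hi hid _ hω.1.2.2 hε (hCε _ hx)).le
    _ < ∞ := by
        rw [lintegral_const_mul' _ _ ENNReal.coe_ne_top]
        exact ENNReal.mul_lt_top ENNReal.coe_lt_top
          (lintegral_dominating_lt_top hk hkq hA (h.1.trans hp.le) hmom ε)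

/-- Convergence for a continuity set, conditionally on the matrix. -/
theorem tendsto_integral_indicator (hk : 1 ≤ k) (hkq : k ≤ q) (hi : 1 ≤ i) (hid : i ≤ d)
    (hZ : Measurable Z) (hb : IsTailQuantile (tailProb P Z i) b)
    (h : MRV P Z α b μ (CA d (i - 1))) {B : Matrix (Fin q) (Fin d) ℝ≥0} (hB : tau k i B < ∞)
    {C : Set (Fin q → ℝ≥0)} (hCm : MeasurableSet C) (hC : BoundedAway (CA q (k - 1)) C)
    (hfr : μ (frontier (preim B C)) = 0) :
    Tendsto (fun t => ∫ x, C.indicator (fun _ => (1 : ℝ)) (B *ᵥ x) ∂(scaledLaw P Z i t)) atTop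
      (𝓝 (∫ x, C.indicator (fun _ => (1 : ℝ)) (B *ᵥ x) ∂μ)) := by
  obtain ⟨ε, hε, hCε⟩ := (boundedAway_iff hk hkq _).1 hC
  have hm : MeasurableSet (preim B C) := measurable_mulVec_right B hCm
  have key := (h.tendstoAway_scaledLaw hi hid hZ hb).tendsto_measureReal hi hid h.2.2.2.1 hm
    (ε := (((tau k i B).toNNReal + 1) * (ε⁻¹ + 1))⁻¹) (by positivity)
    (fun x hx => (inv_lt_ordStat hk hkq hi hid B hB hε (hCε _ hx)).le) hfr
  have hval : ∀ ρ : Measure (Fin d → ℝ≥0),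
      ∫ x, C.indicator (fun _ => (1 : ℝ)) (B *ᵥ x) ∂ρ = ρ.real (preim B C) :=
    fun ρ => integral_indicator_one hm
  simp_rw [hval]
  exact key

/-- Convergence for a test function, conditionally on the matrix. -/
theorem tendsto_integral_testFunction (hk : 1 ≤ k) (hkq : k ≤ q) (hi : 1 ≤ i) (hid : i ≤ d)
    (hZ : Measurable Z) (hb : IsTailQuantile (tailProb P Z i) b)
    (h : MRV P Z α b μ (CA d (i - 1))) {B : Matrix (Fin q) (Fin d) ℝ≥0} (hB : tau k i B < ∞)
    (f : (Fin q → ℝ≥0) →ᵇ ℝ) (hf : BoundedAway (CA q (k - 1)) (Function.support f)) :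
    Tendsto (fun t => ∫ x, f (B *ᵥ x) ∂(scaledLaw P Z i t)) atTop (𝓝 (∫ x, f (B *ᵥ x) ∂μ)) := by
  obtain ⟨ε, hε, hfε⟩ := (boundedAway_iff hk hkq _).1 hf
  refine h.tendstoAway_scaledLaw hi hid hZ hb
    (f.compContinuous ⟨fun x => B *ᵥ x, continuous_matrix_mulVec B⟩) ?_
  refine (boundedAway_iff hi hid _).2 ⟨(((tau k i B).toNNReal + 1) * (ε⁻¹ + 1))⁻¹, by positivity,
    fun x hx => ?_⟩
  exact (inv_lt_ordStat hk hkq hi hid B hB hε (hfε _ hx)).le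

end

/-! ### Summation over the parts -/

section

variable {Ω : Type*} [MeasurableSpace Ω] {P : Measure Ω} {q d k : ℕ}
  {A : Ω → Matrix (Fin q) (Fin d) ℝ≥0} {Z : Ω → Fin d → ℝ≥0}
  {α : ℕ → ℝ} {b : ℕ → ℝ≥0 → ℝ≥0} {μ : ℕ → Measure (Fin d → ℝ≥0)}

theorem exists_isLeast_OmegaPart [IsProbabilityMeasure P] (hk : 1 ≤ k) (hkq : k ≤ q) (hd : 1 ≤ d) :
    ∃ i₀ : ℕ, IsLeast {i : ℕ | 1 ≤ i ∧ i ≤ d ∧ 0 < P (OmegaPart A k i)} i₀ := by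
  have hne : {i : ℕ | 1 ≤ i ∧ i ≤ d ∧ 0 < P (OmegaPart A k i)}.Nonempty := by
    by_contra hempty
    have hall : ∀ i ∈ Finset.Icc 1 d, P (OmegaPart A k i) = 0 := fun i hi => by
      by_contra hpos
      rw [Finset.mem_Icc] at hi
      exact hempty ⟨i, hi.1, hi.2, pos_iff_ne_zero.2 hpos⟩
    have h1 : P (⋃ i ∈ Finset.Icc 1 d, OmegaPart A k i) = 0 :=
      (measure_biUnion_null_iff (Finset.countable_toSet _)).2 hall
    rw [iUnion_OmegaPart hk hkq hd, measure_univ] at h1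
    exact one_ne_zero h1
  exact ⟨_, Nat.sInf_mem hne, fun j hj => Nat.sInf_le hj⟩

theorem integral_eq_sum_OmegaPart (hk : 1 ≤ k) (hkq : k ≤ q) (hd : 1 ≤ d) (hA : Measurable A)
    {F : Ω → ℝ} (hF : Integrable F P) :
    ∫ ω, F ω ∂P = ∑ i ∈ Finset.Icc 1 d, ∫ ω in OmegaPart A k i, F ω ∂P := by
  rw [← integral_biUnion_finset _ (fun i _ => measurableSet_OmegaPart hk hkq hA i)
    (fun i _ j _ hij => pairwise_disjoint_OmegaPart hij) (fun i _ => hF.integrableOn),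
    iUnion_OmegaPart hk hkq hd, setIntegral_univ]

/-- The tails of the order statistics of `Z` are of strictly decreasing order of magnitude. -/
theorem tendsto_tailProb_div_tailProb [IsProbabilityMeasure P] (hZ : Measurable Z)
    (hb : ∀ i ∈ Finset.Icc 1 d, IsTailQuantile (tailProb P Z i) (b i))
    (h : ∀ i ∈ Finset.Icc 1 d, MRV P Z (α i) (b i) (μ i) (CA d (i - 1)))
    (hratio : ∀ i, 1 ≤ i → i + 1 ≤ d → Tendsto (fun t => b i t / b (i + 1) t) atTop atTop)
    {i j : ℕ} (hi : 1 ≤ i) (hij : i < j) (hjd : j ≤ d) :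
    Tendsto (fun t => (tailProb P Z j t : ℝ) / tailProb P Z i t) atTop (𝓝 0) := by
  have hi' : i ∈ Finset.Icc 1 d := Finset.mem_Icc.2 ⟨hi, by omega⟩
  have hs' : i + 1 ∈ Finset.Icc 1 d := Finset.mem_Icc.2 ⟨by omega, by omega⟩
  have hpos := (h _ hs').index_pos (by omega) (by omega) hZ (hb _ hs')
  have h1 := (hb i hi').tendsto_tail_div_tail (hb _ hs') (h i hi').1 (h i hi').2.1 hpos
    (h _ hs').2.1 (hratio i hi (by omega))
  have h2 := (NNReal.continuous_coe.tendsto _).comp h1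
  refine tendsto_of_tendsto_of_tendsto_of_le_of_le tendsto_const_nhds h2
    (fun t => by positivity) fun t => ?_
  change ((tailProb P Z j t : ℝ) / tailProb P Z i t) ≤
    ((tailProb P Z (i + 1) t / tailProb P Z i t : ℝ≥0) : ℝ)
  rw [NNReal.coe_div]
  gcongr
  exact ENNReal.toNNReal_mono (measure_ne_top _ _) (measure_mono fun ω (hω : t < ordStat (Z ω) j) =>
    hω.trans_le (ordStat_antitone (Z ω) (by omega) hij hjd))

/-- Only the part with the smallest index of positive probability contributes to the limit: the
earlier parts are null, the later ones are governed by lighter tails. -/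
theorem tendsto_integral_div_tailProb [IsProbabilityMeasure P] (hk : 1 ≤ k) (hkq : k ≤ q)
    (hA : Measurable A) (hZ : Measurable Z)
    (hb : ∀ i ∈ Finset.Icc 1 d, IsTailQuantile (tailProb P Z i) (b i))
    (h : ∀ i ∈ Finset.Icc 1 d, MRV P Z (α i) (b i) (μ i) (CA d (i - 1)))
    (hratio : ∀ i, 1 ≤ i → i + 1 ≤ d → Tendsto (fun t => b i t / b (i + 1) t) atTop atTop)
    {i₀ : ℕ} (hi₀ : IsLeast {i : ℕ | 1 ≤ i ∧ i ≤ d ∧ 0 < P (OmegaPart A k i)} i₀)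
    {g : (Fin q → ℝ≥0) → ℝ} (hg : Measurable g) {M : ℝ} (hM : ∀ x, |g x| ≤ M) {L : ℕ → ℝ}
    (hlim : ∀ i ∈ Finset.Icc 1 d, Tendsto (fun t => (tailProb P Z i t : ℝ)⁻¹ *
      ∫ ω in OmegaPart A k i, g (t⁻¹ • (A ω *ᵥ Z ω)) ∂P) atTop (𝓝 (L i))) :
    Tendsto (fun t => (tailProb P Z i₀ t : ℝ)⁻¹ * ∫ ω, g (t⁻¹ • (A ω *ᵥ Z ω)) ∂P) atTop
      (𝓝 (L i₀)) := by
  obtain ⟨⟨h1, hid, -⟩, hmin⟩ := hi₀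
  have hmem : i₀ ∈ Finset.Icc 1 d := Finset.mem_Icc.2 ⟨h1, hid⟩
  have hAZm : Measurable fun ω => A ω *ᵥ Z ω := measurable_mulVec.comp (hA.prodMk hZ)
  have hterm : ∀ i ∈ Finset.Icc 1 d, Tendsto (fun t => (tailProb P Z i₀ t : ℝ)⁻¹ *
      ∫ ω in OmegaPart A k i, g (t⁻¹ • (A ω *ᵥ Z ω)) ∂P) atTop
      (𝓝 (if i = i₀ then L i else 0)) := by
    intro i hi
    have hi' := Finset.mem_Icc.1 hi
    rcases lt_trichotomy i i₀ with hlt | rfl | hgt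
    · have hnull : P (OmegaPart A k i) = 0 := by
        by_contra hne
        have := hmin ⟨hi'.1, hi'.2, pos_iff_ne_zero.2 hne⟩
        omega
      simp only [Measure.restrict_eq_zero.2 hnull, integral_zero_measure, mul_zero, if_neg hlt.ne]
      exact tendsto_const_nhds
    · rw [if_pos rfl]
      exact hlim i hi
    · rw [if_neg hgt.ne']
      have := (tendsto_tailProb_div_tailProb hZ hb h hratio h1 hgt hi'.2).mul (hlim i hi)
      rw [zero_mul] at this
      refine this.congr fun t => ?_
      have hT : (tailProb P Z i t : ℝ) ≠ 0 :=
        NNReal.coe_ne_zero.2 ((hb i hi).tail_pos (h i hi).1 (h i hi).2.1 t).ne'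
      field_simp
  have hsum := tendsto_finsetSum (Finset.Icc 1 d) hterm
  rw [Finset.sum_ite_eq' (Finset.Icc 1 d) i₀, if_pos hmem] at hsum
  refine hsum.congr fun t => ?_
  have hint : Integrable (fun ω => g (t⁻¹ • (A ω *ᵥ Z ω))) P :=
    Integrable.of_bound (hg.comp (measurable_nnreal_smul hAZm _)).aestronglyMeasurable M
      (Eventually.of_forall fun ω => hM _)
  rw [integral_eq_sum_OmegaPart hk hkq (h1.trans hid) hA hint, Finset.mul_sum]

theorem setIntegral_indicator_smul (hA : Measurable A) (hZ : Measurable Z)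
    {C : Set (Fin q → ℝ≥0)} (hC : MeasurableSet C) {t : ℝ≥0} (ht : 0 < t) (S : Set Ω) :
    ∫ ω in S, C.indicator (fun _ => (1 : ℝ)) (t⁻¹ • (A ω *ᵥ Z ω)) ∂P =
      P.real ({ω | A ω *ᵥ Z ω ∈ t • C} ∩ S) := by
  have hset : {ω | A ω *ᵥ Z ω ∈ t • C} = (fun ω => t⁻¹ • (A ω *ᵥ Z ω)) ⁻¹' C := by
    ext ω
    rw [Set.mem_ofPred_eq, Set.mem_smul_set_iff_inv_smul_mem₀ ht.ne']
    rfl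
  have hm : MeasurableSet ((fun ω => t⁻¹ • (A ω *ᵥ Z ω)) ⁻¹' C) :=
    measurable_nnreal_smul (measurable_mulVec.comp (hA.prodMk hZ)) _ hC
  rw [hset, ← measureReal_restrict_apply hm]
  exact integral_indicator_one hm

/-! ### The limit measure -/

/-- The measure `B ↦ E_i^{(k)}[ν(A⁻¹(B))]` on `E q k`. -/
noncomputable def limitMeasure (P : Measure Ω) (A : Ω → Matrix (Fin q) (Fin d) ℝ≥0)
    (ν : Measure (Fin d → ℝ≥0)) (k i : ℕ) : Measure (Fin q → ℝ≥0) :=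
  (((P.restrict (OmegaPart A k i)).prod ν).map fun p => A p.1 *ᵥ p.2).restrict (E q k)

variable {i : ℕ} {ν : Measure (Fin d → ℝ≥0)}

theorem measurableSet_E (hk : 1 ≤ k) (hkq : k ≤ q) : MeasurableSet (E q k) :=
  measurableSet_lt measurable_const (measurable_ordStat hk hkq)

theorem measurable_mulVec_prod (hA : Measurable A) :
    Measurable fun p : Ω × (Fin d → ℝ≥0) => A p.1 *ᵥ p.2 :=
  measurable_mulVec.comp ((hA.comp measurable_fst).prodMk measurable_snd)

theorem limitMeasure_apply [SFinite ν] (hA : Measurable A) {B : Set (Fin q → ℝ≥0)}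
    (hB : MeasurableSet B) (hBE : B ⊆ E q k) :
    limitMeasure P A ν k i B = meanMass P A ν k i B := by
  rw [limitMeasure, Measure.restrict_apply hB, Set.inter_eq_left.2 hBE,
    Measure.map_apply (measurable_mulVec_prod hA) hB,
    Measure.prod_apply (measurable_mulVec_prod hA hB)]
  rfl

theorem inM_limitMeasure [SFinite ν] (hk : 1 ≤ k) (hkq : k ≤ q) (hA : Measurable A)
    (hfin : ∀ B, BoundedAway (CA q (k - 1)) B → meanMass P A ν k i B < ∞) :
    InM (CA q (k - 1)) (limitMeasure P A ν k i) := by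
  refine ⟨?_, fun B hB hBA => ?_⟩
  · have hCA : CA q (k - 1) ⊆ (E q k)ᶜ := fun x hx hxE =>
      absurd ((mem_CA_pred hk x).1 hx) (ne_of_gt hxE)
    exact measure_mono_null hCA (by
      rw [limitMeasure, Measure.restrict_apply (measurableSet_E hk hkq).compl, Set.compl_inter_self,
        measure_empty])
  · obtain ⟨ε, hε, hBε⟩ := (boundedAway_iff hk hkq _).1 hBA
    rw [limitMeasure_apply hA hB fun x hx => hε.trans_le (hBε x hx)]
    exact hfin B hBA

theorem integral_limitMeasure [SFinite P] [SFinite ν] (hk : 1 ≤ k) (hkq : k ≤ q) (hA : Measurable A)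
    (hInM : InM (CA q (k - 1)) (limitMeasure P A ν k i)) (f : (Fin q → ℝ≥0) →ᵇ ℝ)
    (hf : BoundedAway (CA q (k - 1)) (Function.support f)) :
    ∫ x, f x ∂(limitMeasure P A ν k i) =
      ∫ ω in OmegaPart A k i, ∫ x, f (A ω *ᵥ x) ∂ν ∂P := by
  obtain ⟨ε, hε, hfε⟩ := (boundedAway_iff hk hkq _).1 hf
  have hm := f.continuous.measurable
  have hsupp : Function.support f ⊆ E q k := fun x hx => hε.trans_le (hfε x hx)
  have hint : Integrable f (limitMeasure P A ν k i) :=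
    hInM.integrable hk hkq hm (fun x => f.norm_coe_le_norm x) hε hfε
  have hint' := (integrableOn_iff_integrable_of_support_subset hsupp).1 hint
  rw [integrable_map_measure hm.aestronglyMeasurable
    (measurable_mulVec_prod hA).aemeasurable] at hint'
  rw [limitMeasure, setIntegral_eq_integral_of_forall_compl_eq_zero fun x hx =>
      by_contra fun hne => hx (hsupp hne),
    integral_map (measurable_mulVec_prod hA).aemeasurable hm.aestronglyMeasurable]
  exact integral_prod _ hint'

/-- Every matrix in `OmegaPart A k i` without zero row maps some face of dimension `i` into
`E q k`, and all these faces are charged by `ν`. -/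
theorem limitMeasure_ne_zero [SFinite ν] (hk : 1 ≤ k) (hkq : k ≤ q) (hA : Measurable A)
    (hrows : ∀ᵐ ω ∂P, ∀ l : Fin q, A ω l ≠ 0)
    (hface : ∀ S : Finset (Fin d), S.card = i → 0 < ν (face S))
    (hpos : 0 < P (OmegaPart A k i)) : limitMeasure P A ν k i ≠ 0 := by
  intro h0
  have hE := limitMeasure_apply (P := P) (ν := ν) (i := i) hA (measurableSet_E hk hkq)
    (subset_refl (E q k))
  rw [h0, Measure.coe_zero, Pi.zero_apply, meanMass, eq_comm,
    lintegral_eq_zero_iff (measurable_measure_preim hA (measurableSet_E hk hkq))] at hE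
  have hfalse : ∀ᵐ ω ∂P.restrict (OmegaPart A k i), False := by
    filter_upwards [hE, ae_restrict_of_ae hrows,
      ae_restrict_mem (measurableSet_OmegaPart hk hkq hA i)] with ω h1 h2 h3
    obtain ⟨S, hS, hSE⟩ := exists_face_subset_preim hk hkq (A ω) h2 h3
    exact absurd h1 ((hface S hS).trans_le (measure_mono hSE)).ne'
  rw [ae_iff] at hfalse
  simp only [not_false_eq_true, Set.ofPred_true, Measure.restrict_apply_univ] at hfalse
  exact hpos.ne' hfalse

end

end Breiman

theorem mainTheorem2 {Ω : Type*} [MeasurableSpace Ω] (P : Measure Ω) [IsProbabilityMeasure P]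
    (q d k : ℕ) (hk : 1 ≤ k) (hkq : k ≤ q)
    (Z : Ω → Fin d → ℝ≥0) (hZ : Measurable Z)
    (A : Ω → Matrix (Fin q) (Fin d) ℝ≥0) (hA : Measurable A) (hAZ : IndepFun A Z P)
    (hrows : ∀ᵐ ω ∂P, ∀ l : Fin q, A ω l ≠ 0)
    (α : ℕ → ℝ) (b : ℕ → ℝ≥0 → ℝ≥0) (μ : ℕ → Measure (Fin d → ℝ≥0))
    (hb : ∀ i ∈ Finset.Icc 1 d, b i = canonicalScale P Z i)
    (hMRV : ∀ i ∈ Finset.Icc 1 d, MRV P Z (α i) (b i) (μ i) (CA d (i - 1)))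
    (hratio : ∀ i, 1 ≤ i → i + 1 ≤ d → Tendsto (fun t => b i t / b (i + 1) t) atTop atTop)
    (hmoment : ∀ i ∈ Finset.Icc 1 d, ∃ δ : ℝ, 0 < δ ∧
      ∫⁻ ω in OmegaPart A k i, tau k i (A ω) ^ (α i + δ) ∂P < ∞)
    (hface : ∀ i ∈ Finset.Icc 1 d, ∀ S : Finset (Fin d), S.card = i → 0 < μ i (face S)) :
    -- (a)
    (∀ C : Set (Fin q → ℝ≥0), TestSet P A μ k C →
      (∀ i ∈ Finset.Icc 1 d, meanMass P A (μ i) k i C < ∞) ∧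
      ∃ ε : ℕ → ℝ≥0 → ℝ,
        (∀ i ∈ Finset.Icc 1 d, Tendsto (ε i) atTop (𝓝 0)) ∧
        (∀ i ∈ Finset.Icc 1 d, ∀ᶠ t : ℝ≥0 in atTop,
          P.real ({ω | A ω *ᵥ Z ω ∈ t • C} ∩ OmegaPart A k i) =
            P.real {ω | t < ordStat (Z ω) i} *
              ((meanMass P A (μ i) k i C).toReal + ε i t)) ∧
        ∀ᶠ t : ℝ≥0 in atTop,
          P.real {ω | A ω *ᵥ Z ω ∈ t • C} =
            ∑ i ∈ Finset.Icc 1 d, P.real {ω | t < ordStat (Z ω) i} *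
              ((meanMass P A (μ i) k i C).toReal + ε i t)) ∧
    -- (b)
    (∃ i₀ : ℕ, IsLeast {i : ℕ | 1 ≤ i ∧ i ≤ d ∧ 0 < P (OmegaPart A k i)} i₀ ∧
      (∀ C : Set (Fin q → ℝ≥0), TestSet P A μ k C →
        Tendsto (fun t : ℝ≥0 =>
            P.real {ω | A ω *ᵥ Z ω ∈ t • C} / P.real {ω | t < ordStat (Z ω) i₀})
          atTop (𝓝 (meanMass P A (μ i₀) k i₀ C).toReal)) ∧
      ∃ μbar : Measure (Fin q → ℝ≥0),
        (∀ B : Set (Fin q → ℝ≥0), MeasurableSet B → B ⊆ E q k →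
          μbar B = meanMass P A (μ i₀) k i₀ B) ∧
        MTendsto (CA q (k - 1))
          (fun t : ℝ≥0 => (P {ω | t < ordStat (Z ω) i₀})⁻¹ •
            P.map fun ω => t⁻¹ • (A ω *ᵥ Z ω)) μbar ∧
        ∃ bbar : ℝ≥0 → ℝ≥0,
          MRV P (fun ω => A ω *ᵥ Z ω) (α i₀) bbar μbar (CA q (k - 1))) := by
  have hd : 1 ≤ d := by
    -- for `d = 0` every row of a matrix is zero
    by_contra hd0
    obtain rfl : d = 0 := by omega
    obtain ⟨ω, hω⟩ := hrows.exists
    exact hω ⟨0, by omega⟩ (funext fun j => j.elim0)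
  have hq : ∀ i ∈ Finset.Icc 1 d, IsTailQuantile (tailProb P Z i) (b i) := fun i hi => by
    rw [hb i hi]
    exact isTailQuantile_canonicalScale (Finset.mem_Icc.1 hi).1 (Finset.mem_Icc.1 hi).2 hZ
  have hAZm : Measurable fun ω => A ω *ᵥ Z ω := measurable_mulVec.comp (hA.prodMk hZ)
  have hTpos : ∀ i ∈ Finset.Icc 1 d, ∀ t, 0 < tailProb P Z i t := fun i hi =>
    (hq i hi).tail_pos (hMRV i hi).1 (hMRV i hi).2.1
  have hmean : ∀ i ∈ Finset.Icc 1 d, ∀ C, BoundedAway (CA q (k - 1)) C →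
      meanMass P A (μ i) k i C < ∞ := fun i hi C hC => by
    obtain ⟨δ, hδ, hmom⟩ := hmoment i hi
    exact meanMass_lt_top hk hkq (Finset.mem_Icc.1 hi).1 (Finset.mem_Icc.1 hi).2 hA hZ (hq i hi)
      (hMRV i hi) (lt_add_of_pos_right _ hδ) hmom hC
  have hind : ∀ (C : Set (Fin q → ℝ≥0)) (x : Fin q → ℝ≥0),
      |C.indicator (fun _ => (1 : ℝ)) x| ≤ 1 := fun C x => by
    by_cases hx : x ∈ C <;> simp [hx]
  have hpart : ∀ C, TestSet P A μ k C → ∀ i ∈ Finset.Icc 1 d,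
      Tendsto (fun t => (tailProb P Z i t : ℝ)⁻¹ * ∫ ω in OmegaPart A k i,
        C.indicator (fun _ => (1 : ℝ)) (t⁻¹ • (A ω *ᵥ Z ω)) ∂P) atTop
        (𝓝 (meanMass P A (μ i) k i C).toReal) := by
    intro C hC i hi
    have hi' := Finset.mem_Icc.1 hi
    obtain ⟨-, hCm, hCA, hfr⟩ := hC
    obtain ⟨δ, hδ, hmom⟩ := hmoment i hi
    obtain ⟨ε, hε, hCε⟩ := (boundedAway_iff hk hkq _).1 hCA
    rw [← toReal_meanMass hk hkq hi'.1 hi'.2 hA (hMRV i hi).2.2.2.1 hCm hCA]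
    refine tendsto_setIntegral_OmegaPart hk hkq hi'.1 hi'.2 hA hZ hAZ (hq i hi) (hMRV i hi)
      (lt_add_of_pos_right _ hδ) hmom (measurable_const.indicator hCm) (hind C) hε
      (fun x hx => hCε x (Set.mem_of_indicator_ne_zero hx)) ?_
    filter_upwards [hfr i hi] with ω hω hωi
    exact tendsto_integral_indicator hk hkq hi'.1 hi'.2 hZ (hq i hi) (hMRV i hi) hωi.1.2.2 hCm hCA
      (hω hωi)
  obtain ⟨i₀, hi₀⟩ := exists_isLeast_OmegaPart (P := P) (A := A) hk hkq hd
  have hi₀' : i₀ ∈ Finset.Icc 1 d := Finset.mem_Icc.2 ⟨hi₀.1.1, hi₀.1.2.1⟩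
  have hInM := (hMRV i₀ hi₀').2.2.2.1
  have := hInM.sigmaFinite hi₀.1.1 hi₀.1.2.1
  have hInMbar : InM (CA q (k - 1)) (limitMeasure P A (μ i₀) k i₀) :=
    inM_limitMeasure hk hkq hA (hmean i₀ hi₀')
  have hfun : ∀ f : (Fin q → ℝ≥0) →ᵇ ℝ, BoundedAway (CA q (k - 1)) (Function.support f) →
      Tendsto (fun t => (tailProb P Z i₀ t : ℝ)⁻¹ * ∫ ω, f (t⁻¹ • (A ω *ᵥ Z ω)) ∂P) atTop
        (𝓝 (∫ x, f x ∂(limitMeasure P A (μ i₀) k i₀))) := by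
    intro f hf
    rw [integral_limitMeasure hk hkq hA hInMbar f hf]
    refine tendsto_integral_div_tailProb hk hkq hA hZ hq hMRV hratio hi₀
      f.continuous.measurable (fun x => f.norm_coe_le_norm x)
      (L := fun i => ∫ ω in OmegaPart A k i, ∫ x, f (A ω *ᵥ x) ∂(μ i) ∂P) fun i hi => ?_
    have hi' := Finset.mem_Icc.1 hi
    obtain ⟨δ, hδ, hmom⟩ := hmoment i hi
    obtain ⟨ε, hε, hfε⟩ := (boundedAway_iff hk hkq _).1 hf
    exact tendsto_setIntegral_OmegaPart hk hkq hi'.1 hi'.2 hA hZ hAZ (hq i hi) (hMRV i hi)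
      (lt_add_of_pos_right _ hδ) hmom f.continuous.measurable (fun x => f.norm_coe_le_norm x) hε hfε
      (Eventually.of_forall fun ω hω => tendsto_integral_testFunction hk hkq hi'.1 hi'.2 hZ
        (hq i hi) (hMRV i hi) hω.1.2.2 f hf)
  refine ⟨fun C hC => ⟨fun i hi => hmean i hi C hC.2.2.1, fun i t =>
    (tailProb P Z i t : ℝ)⁻¹ * P.real ({ω | A ω *ᵥ Z ω ∈ t • C} ∩ OmegaPart A k i) -
      (meanMass P A (μ i) k i C).toReal, fun i hi => ?_, fun i hi => ?_, ?_⟩,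
    i₀, hi₀, fun C hC => ?_, limitMeasure P A (μ i₀) k i₀, fun B hB hBE =>
      limitMeasure_apply hA hB hBE, ⟨hInMbar, fun f hf => ?_⟩, b i₀, (hMRV i₀ hi₀').1,
      (hMRV i₀ hi₀').2.1, limitMeasure_ne_zero hk hkq hA hrows (hface i₀ hi₀') hi₀.1.2.2,
      hInMbar, fun f hf => ?_⟩
  · have := (hpart C hC i hi).sub_const (meanMass P A (μ i) k i C).toReal
    rw [sub_self] at this
    refine this.congr' ?_
    filter_upwards [eventually_gt_atTop 0] with t ht
    rw [setIntegral_indicator_smul hA hZ hC.2.1 ht]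
  · refine Eventually.of_forall fun t => ?_
    rw [add_sub_cancel, ← coe_tailProb,
      mul_inv_cancel_left₀ (NNReal.coe_ne_zero.2 (hTpos i hi t).ne')]
  · filter_upwards [eventually_gt_atTop 0] with t ht
    have hint : Integrable (fun ω => C.indicator (fun _ => (1 : ℝ)) (t⁻¹ • (A ω *ᵥ Z ω))) P :=
      Integrable.of_bound ((measurable_const.indicator hC.2.1).comp
        (measurable_nnreal_smul hAZm _)).aestronglyMeasurable 1
        (Eventually.of_forall fun ω => hind C _)
    have h1 := setIntegral_indicator_smul (P := P) hA hZ hC.2.1 ht Set.univ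
    rw [Set.inter_univ, setIntegral_univ] at h1
    rw [← h1, integral_eq_sum_OmegaPart hk hkq hd hA hint]
    refine Finset.sum_congr rfl fun i hi => ?_
    rw [setIntegral_indicator_smul hA hZ hC.2.1 ht, add_sub_cancel, ← coe_tailProb,
      mul_inv_cancel_left₀ (NNReal.coe_ne_zero.2 (hTpos i hi t).ne')]
  · refine (tendsto_integral_div_tailProb hk hkq hA hZ hq hMRV hratio hi₀
      (measurable_const.indicator hC.2.1) (hind C) (hpart C hC)).congr' ?_
    filter_upwards [eventually_gt_atTop 0] with t ht
    have h1 := setIntegral_indicator_smul (P := P) hA hZ hC.2.1 ht Set.univ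
    rw [Set.inter_univ, setIntegral_univ] at h1
    rw [h1, coe_tailProb, inv_mul_eq_div]
  · refine (hfun f hf).congr fun t => ?_
    beta_reduce
    rw [← ennreal_coe_tailProb, ← ENNReal.coe_inv (hTpos i₀ hi₀' t).ne', ← NNReal.coe_inv]
    exact (integral_smul_map hAZm _ _ f.continuous.measurable).symm
  · have hq₀ := hq i₀ hi₀'
    have h1 := (NNReal.continuous_coe.tendsto _).comp
      (hq₀.tendsto_mul_tail_quantile (hMRV i₀ hi₀').1 (hMRV i₀ hi₀').2.1)
    have h2 := h1.mul ((hfun f hf).comp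
      (hq₀.tendsto_quantile (hMRV i₀ hi₀').1 (hMRV i₀ hi₀').2.1))
    rw [NNReal.coe_one, one_mul] at h2
    refine h2.congr fun t => ?_
    have hT : (tailProb P Z i₀ (b i₀ t) : ℝ) ≠ 0 := NNReal.coe_ne_zero.2 (hTpos i₀ hi₀' _).ne'
    rw [integral_smul_map hAZm _ _ f.continuous.measurable]
    simp only [Function.comp_apply, NNReal.coe_mul]
    field_simp
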